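/- Let $Z(t)=e^{i\vartheta(t)}\zeta\left(\tfrac12+it\right)$, $\vartheta(t)=-\tfrac t2\ln\pi+\operatorname{Im}\ln\Gamma\left(\tfrac14+\tfrac{it}2\right)$, be Hardy's function. Let $y_0>0$ and let $\mu:[y_0,\infty)\to(0,\infty)$ be an admissible function, that is, $\mu$ is continuously differentiable and nondecreasing with $\mu(y)\ge 7y\ln y$ for all $y\ge y_0$. For $y\ge y_0$ put $$\Phi(y)=\int_0^{\mu(y)}Z^2(t)\,e^{-\frac2y t}\,dt .$$ Let $\varphi(T)\in[y_0,\infty)$ be the solution $y=\varphi(T)$ of the equation $\Phi(y)=\int_0^T Z^2(t)\,dt$, let $D\subset[0,\infty)$ be the set of all $T\ge0$ for which such a solution exists, and let $\varphi_1=\tfrac12\varphi$ on $D$ be the corresponding Jacob's ladder. Put $$\tilde Z^2(t)=\frac{Z^2(t)}{2\,\Phi'(\varphi(t))},$$ let $\varphi_1^0(t)=t$ and let $\varphi_1^r$ be the $r$-th iterate of $\varphi_1$. For real $x$, the reverse iterates of $x$ are defined by $\overset{0}{x}=x$ and $\varphi_1(\overset{k}{x})=\overset{k-1}{x}$, $\overset{k}{x}\in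 D$; when $x$ is an expression such as $\overset{j}{T}+g$, its $k$-th reverse iterate is written $\overset{k}{\overbrace{\overset{j}{T}+g}}$. For every fixed $g\in(0,\infty)$ there is $T_0=T_0[\varphi_1;g]>0$ such that for every integer $k_0\ge2$, every $T\in(T_0,\infty)$ and every $k$ with $2\le k\le k_0$ all the reverse iterates that occur below exist, and every entry of the triangular matrix of reversely iterated integrals is equal to $g$: $$\int_{\overset{p}{T}}^{\overset{s}{\overbrace{\overset{p-s}{T}+g}}}\ \prod_{r=0}^{s-1}\tilde Z^2[\varphi_1^r(t)]\,dt=g,\qquad s=1,\dots,p-1,\quad p=2,\dots,k .$$ So all integrals in a row $p$, which start at the same point $\overset{p}{T}$, are equal to one another, and the rows are equal to one another. -/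

import Mathlib

noncomputable section

namespace JacobLadder

/-- The Riemann-Siegel angle `ϑ(t) = -(t/2) ln π + Im ln Γ(1/4 + i t/2)`, taken with the principal
branch of the logarithm; it enters only through `exp (i ϑ(t))`, which does not depend on the branch. -/
def hardyTheta (t : ℝ) : ℝ :=
  -(t / 2) * Real.log Real.pi
    + (Complex.log (Complex.Gamma (1 / 4 + Complex.I * ((t / 2 : ℝ) : ℂ)))).im

/-- Hardy's function `Z(t) = exp (i ϑ(t)) ζ(1/2 + i t)`. It takes real values, so that its square is
the square of its absolute value. -/
def hardyZ (t : ℝ) : ℂ :=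
  Complex.exp (Complex.I * ((hardyTheta t : ℝ) : ℂ)) * riemannZeta (1 / 2 + Complex.I * (t : ℂ))

/-- `Z(t)^2`. -/
def hardyZSq (t : ℝ) : ℝ := ‖hardyZ t‖ ^ 2

/-- The Hardy-Littlewood integral `∫_0^T Z(t)^2 dt`. -/
def hardyLittlewood (T : ℝ) : ℝ := ∫ t in (0 : ℝ)..T, hardyZSq t

/-- `Φ(y) = ∫_0^{μ(y)} Z(t)^2 exp (-(2/y) t) dt`. -/
def Phi (μ : ℝ → ℝ) (y : ℝ) : ℝ :=
  ∫ t in (0 : ℝ)..(μ y), hardyZSq t * Real.exp (-(2 / y) * t)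

/-- Admissible functions: continuously differentiable, nondecreasing and positive on `[y₀, ∞)`, with
`μ(y) ≥ 7 y ln y` there. -/
structure IsAdmissible (μ : ℝ → ℝ) (y₀ : ℝ) : Prop where
  pos_start : 0 < y₀
  contDiffOn : ContDiffOn ℝ 1 μ (Set.Ici y₀)
  monotoneOn : MonotoneOn μ (Set.Ici y₀)
  pos : ∀ y, y₀ ≤ y → 0 < μ y
  bound : ∀ y, y₀ ≤ y → 7 * y * Real.log y ≤ μ y

/-- The set of those `T ≥ 0` for which the integral equation
`∫_0^{μ(y)} Z(t)^2 exp (-(2/y) t) dt = ∫_0^T Z(t)^2 dt` has a solution `y ≥ y₀`. -/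
def ladderDomain (μ : ℝ → ℝ) (y₀ : ℝ) : Set ℝ :=
  {T | 0 ≤ T ∧ ∃ y, y₀ ≤ y ∧ Phi μ y = hardyLittlewood T}

/-- `φ(T)`: the solution `y ≥ y₀` of the integral equation, for `T` in `ladderDomain μ y₀`
(a junk value elsewhere). -/
def phi (μ : ℝ → ℝ) (y₀ : ℝ) (T : ℝ) : ℝ :=
  Function.invFunOn (Phi μ) (Set.Ici y₀) (hardyLittlewood T)

/-- The Jacob's ladder `φ₁ = φ / 2`. -/
def phi1 (μ : ℝ → ℝ) (y₀ : ℝ) (T : ℝ) : ℝ := phi μ y₀ T / 2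

/-- `Z̃²(t) = Z(t)^2 / (2 Φ'(φ(t)))`. -/
def tildeZSq (μ : ℝ → ℝ) (y₀ : ℝ) (t : ℝ) : ℝ :=
  hardyZSq t / (2 * deriv (Phi μ) (phi μ y₀ t))

/-- The `k`-th reverse iterate of `T`: it is `T` for `k = 0`, and the `(k + 1)`-st reverse iterate is the
point of the domain of `φ₁` that `φ₁` maps to the `k`-th one. -/
def revIter (μ : ℝ → ℝ) (y₀ : ℝ) : ℕ → ℝ → ℝ
  | 0, T => T
  | k + 1, T => Function.invFunOn (phi1 μ y₀) (ladderDomain μ y₀) (revIter μ y₀ k T)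

/-- The first `k` reverse iterates of `T` exist. -/
def HasRevIter (μ : ℝ → ℝ) (y₀ : ℝ) (k : ℕ) (T : ℝ) : Prop :=
  ∀ j, j < k → revIter μ y₀ (j + 1) T ∈ ladderDomain μ y₀ ∧
    phi1 μ y₀ (revIter μ y₀ (j + 1) T) = revIter μ y₀ j T

end JacobLadder

end

namespace JacobLadder

open MeasureTheory Set Filter Topology FourierTransform
open scoped ENNReal ContDiff

noncomputable section

/-- On `L¹ ∩ L²` the `L²` Fourier transform is given by the Fourier integral. -/
theorem coeFn_fourier_toLp_ae_eq {F : ℝ → ℂ} (h1 : Integrable F) (h2 : MemLp F 2) :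
    (𝓕 (h2.toLp F) : Lp ℂ 2 (volume : Measure ℝ)) =ᵐ[volume] 𝓕 F := by
  have hcont : Continuous (𝓕 F) :=
    VectorFourier.fourierIntegral_continuous Real.continuous_fourierChar
      (by exact continuous_inner) h1
  apply ae_eq_of_integral_contDiff_smul_eq
  · exact (Lp.memLp _).locallyIntegrable one_le_two
  · exact hcont.locallyIntegrable
  · intro g g_smooth g_cpt
    have hg₁ : HasCompactSupport (Complex.ofRealCLM ∘ g) := g_cpt.comp_left rfl
    have hg₂ : ContDiff ℝ ∞ (Complex.ofRealCLM ∘ g) := by fun_prop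
    set φ : SchwartzMap ℝ ℂ := hg₁.toSchwartzMap hg₂ with hφ
    have e1 : ∫ x, g x • (𝓕 (h2.toLp F) : Lp ℂ 2 (volume : Measure ℝ)) x
        = Lp.toTemperedDistribution (𝓕 (h2.toLp F) : Lp ℂ 2 (volume : Measure ℝ)) φ := by
      simp [Lp.toTemperedDistribution_apply, hφ]
    rw [e1, ← Lp.fourier_toTemperedDistribution_eq, TemperedDistribution.fourier_apply,
      Lp.toTemperedDistribution_apply]
    have e2 : ∫ x, (𝓕 φ) x • (h2.toLp F) x = ∫ x, (𝓕 φ) x • F x := by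
      apply integral_congr_ae
      filter_upwards [h2.coeFn_toLp] with x hx
      rw [hx]
    rw [e2, SchwartzMap.fourier_coe]
    have e3 := VectorFourier.integral_fourierIntegral_smul_eq_flip (μ := volume) (ν := volume)
      (L := innerₗ ℝ) (f := (φ : ℝ → ℂ)) (g := F) Real.continuous_fourierChar
      (by exact continuous_inner) φ.integrable h1
    rw [flip_innerₗ] at e3
    refine Eq.trans e3 ?_
    simp [hφ]
    rfl

/-- Plancherel's theorem on `L¹ ∩ L²`. -/
theorem lintegral_enorm_fourier_sq {F : ℝ → ℂ} (h1 : Integrable F) (h2 : MemLp F 2) :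
    ∫⁻ ξ, ‖𝓕 F ξ‖ₑ ^ 2 = ∫⁻ u, ‖F u‖ₑ ^ 2 := by
  have key : eLpNorm (𝓕 F) 2 volume = eLpNorm F 2 volume := by
    rw [← eLpNorm_congr_ae (coeFn_fourier_toLp_ae_eq h1 h2), ← eLpNorm_congr_ae h2.coeFn_toLp]
    have := Lp.norm_fourier_eq (h2.toLp F)
    rw [Lp.norm_def, Lp.norm_def, ENNReal.toReal_eq_toReal_iff' (Lp.eLpNorm_ne_top _)
      (Lp.eLpNorm_ne_top _)] at this
    exact this
  have a := eLpNorm_nnreal_pow_eq_lintegral (p := 2) (f := 𝓕 F) (μ := volume) two_ne_zero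
  have b := eLpNorm_nnreal_pow_eq_lintegral (p := 2) (f := F) (μ := volume) two_ne_zero
  simp only [NNReal.coe_ofNat, ENNReal.coe_ofNat, ENNReal.rpow_ofNat] at a b
  rw [← a, ← b, key]

/-- The fractional part, cut off to `[1, ∞)`. -/
def fractTail (t : ℝ) : ℂ := indicator (Ici 1) (fun t : ℝ => ((Int.fract t : ℝ) : ℂ)) t

theorem measurable_fractTail : Measurable fractTail :=
  (Complex.measurable_ofReal.comp measurable_fract).indicator measurableSet_Ici

theorem norm_fractTail_le_one (t : ℝ) : ‖fractTail t‖ ≤ 1 := by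
  unfold fractTail
  refine (norm_indicator_le_norm_self _ _).trans ?_
  rw [Complex.norm_real, Real.norm_eq_abs, abs_of_nonneg (Int.fract_nonneg t)]
  exact (Int.fract_lt_one t).le

theorem fractTail_inv_of_gt {x : ℝ} (hx : 1 < x) : fractTail x⁻¹ = 0 := by
  unfold fractTail
  apply indicator_of_notMem
  simpa using inv_lt_one_of_one_lt₀ hx

theorem fractTail_inv_of_le {x : ℝ} (h0 : 0 < x) (hx : x ≤ 1) :
    fractTail x⁻¹ = ((Int.fract x⁻¹ : ℝ) : ℂ) := by
  unfold fractTail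
  exact indicator_of_mem (by simpa using (one_le_inv₀ h0).2 hx) _

theorem locallyIntegrableOn_fractTail_inv :
    LocallyIntegrableOn (fun x : ℝ => fractTail x⁻¹) (Ioi 0) := by
  have : LocallyIntegrable (fun x : ℝ => fractTail x⁻¹) := by
    refine (locallyIntegrable_const (1 : ℝ)).mono
      (measurable_fractTail.comp measurable_inv).aestronglyMeasurable ?_
    filter_upwards with x
    simpa using norm_fractTail_le_one x⁻¹
  exact this.locallyIntegrableOn _

theorem fractTail_inv_isBigO_atTop (a : ℝ) :
    (fun x : ℝ => fractTail x⁻¹) =O[atTop] (· ^ (-a)) := by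
  refine (EventuallyEq.trans_isBigO ?_ (Asymptotics.isBigO_zero _ _))
  filter_upwards [eventually_gt_atTop 1] with x hx using fractTail_inv_of_gt hx

theorem fractTail_inv_isBigO_zero :
    (fun x : ℝ => fractTail x⁻¹) =O[𝓝[>] 0] (· ^ (-(0 : ℝ))) := by
  refine Asymptotics.IsBigO.of_bound 1 (Eventually.of_forall fun x => ?_)
  simpa using norm_fractTail_le_one x⁻¹

theorem mellinConvergent_fractTail_inv {s : ℂ} (hs : 0 < s.re) :
    MellinConvergent (fun x : ℝ => fractTail x⁻¹) s :=
  mellinConvergent_of_isBigO_rpow locallyIntegrableOn_fractTail_inv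
    (fractTail_inv_isBigO_atTop (s.re + 1)) (by linarith) fractTail_inv_isBigO_zero hs

theorem differentiableAt_mellin_fractTail_inv {s : ℂ} (hs : 0 < s.re) :
    DifferentiableAt ℂ (mellin fun x : ℝ => fractTail x⁻¹) s :=
  mellin_differentiableAt_of_isBigO_rpow locallyIntegrableOn_fractTail_inv
    (fractTail_inv_isBigO_atTop (s.re + 1)) (by linarith) fractTail_inv_isBigO_zero hs

theorem mellin_fractTail_inv (s : ℂ) :
    mellin (fun x : ℝ => fractTail x⁻¹) s
      = ∫ t in Ioi (1 : ℝ), ((Int.fract t : ℝ) : ℂ) * (t : ℂ) ^ (-(s + 1)) := by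
  rw [mellin_comp_inv, mellin, ← integral_Ici_eq_integral_Ioi (x := (1 : ℝ)),
    ← integral_indicator measurableSet_Ioi, ← integral_indicator measurableSet_Ici]
  congr 1
  ext t
  by_cases h1 : (1 : ℝ) ≤ t
  · rw [indicator_of_mem (show t ∈ Ioi (0 : ℝ) from lt_of_lt_of_le one_pos h1),
      indicator_of_mem (show t ∈ Ici (1 : ℝ) from h1), fractTail,
      indicator_of_mem (show t ∈ Ici (1 : ℝ) from h1), smul_eq_mul, mul_comm]
    congr 2
    ring
  · rw [indicator_of_notMem (show t ∉ Ici (1 : ℝ) from h1)]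
    by_cases h0 : t ∈ Ioi (0 : ℝ)
    · rw [indicator_of_mem h0, fractTail, indicator_of_notMem (show t ∉ Ici (1 : ℝ) from h1),
        smul_zero]
    · rw [indicator_of_notMem h0]

theorem riemannZeta_eq_of_one_lt_re {s : ℂ} (hs : 1 < s.re) :
    riemannZeta s = s / (s - 1) - s * mellin (fun x : ℝ => fractTail x⁻¹) s := by
  have hO : (fun n : ℕ ↦ ∑ k ∈ Finset.Icc 1 n, (1 : ℕ → ℂ) k)
      =O[atTop] fun n ↦ (n : ℝ) ^ (1 : ℝ) := by
    refine Asymptotics.IsBigO.of_bound 1 (Eventually.of_forall fun n => ?_)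
    simp
  have h1 := LSeries_eq_mul_integral 1 zero_le_one hs (LSeriesSummable_one_iff.2 hs) hO
  rw [LSeries_one_eq_riemannZeta hs] at h1
  have hm : s ≠ 1 := by rintro rfl; simp at hs
  have i1 : IntegrableOn (fun t : ℝ => (t : ℂ) ^ (-s)) (Ioi 1) :=
    integrableOn_Ioi_cpow_of_lt (by simpa using hs) one_pos
  have i2 : IntegrableOn (fun t : ℝ => ((Int.fract t : ℝ) : ℂ) * (t : ℂ) ^ (-(s + 1))) (Ioi 1) := by
    refine (integrableOn_Ioi_cpow_of_lt (a := -(s + 1)) (c := 1)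
      (by simp; linarith) one_pos).bdd_mul (c := 1) ?_ ?_
    · exact (Complex.measurable_ofReal.comp measurable_fract).aestronglyMeasurable
    · filter_upwards with t
      rw [Complex.norm_real, Real.norm_eq_abs, abs_of_nonneg (Int.fract_nonneg t)]
      exact (Int.fract_lt_one t).le
  rw [h1, mellin_fractTail_inv]
  have e : ∫ t in Ioi (1 : ℝ), (∑ k ∈ Finset.Icc 1 ⌊t⌋₊, (1 : ℕ → ℂ) k) * (t : ℂ) ^ (-(s + 1))
      = ∫ t in Ioi (1 : ℝ), ((t : ℂ) ^ (-s)
          - ((Int.fract t : ℝ) : ℂ) * (t : ℂ) ^ (-(s + 1))) := by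
    refine setIntegral_congr_fun measurableSet_Ioi fun t ht => ?_
    have ht0 : (0 : ℝ) < t := lt_trans one_pos ht
    have htc : (t : ℂ) ≠ 0 := by exact_mod_cast ht0.ne'
    have e1 : (∑ k ∈ Finset.Icc 1 ⌊t⌋₊, (1 : ℕ → ℂ) k) = (t : ℂ) - ((Int.fract t : ℝ) : ℂ) := by
      have : (⌊t⌋₊ : ℝ) = t - Int.fract t := by
        rw [natCast_floor_eq_intCast_floor ht0.le]
        linarith [Int.floor_add_fract t]
      rw [← Complex.ofReal_sub, ← this]
      simp
    have e2 : (t : ℂ) ^ (-s) = (t : ℂ) * (t : ℂ) ^ (-(s + 1)) := by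
      rw [show -s = 1 + -(s + 1) by ring, Complex.cpow_add _ _ htc, Complex.cpow_one]
    simp only [e1, e2]
    ring
  rw [e, integral_sub i1 i2, integral_Ioi_cpow_of_lt (by simpa using hs) one_pos]
  have : s - 1 ≠ 0 := sub_ne_zero.2 hm
  have h' : -s + 1 ≠ 0 := by
    intro h; apply hm; linear_combination -h
  simp only [Complex.ofReal_one, Complex.one_cpow]
  field_simp
  ring

theorem riemannZeta_eq_of_re_pos {s : ℂ} (hs : 0 < s.re) (h1 : s ≠ 1) :
    riemannZeta s = s / (s - 1) - s * mellin (fun x : ℝ => fractTail x⁻¹) s := by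
  set U : Set ℂ := {s | 0 < s.re} with hU
  have hUo : IsOpen U := isOpen_lt continuous_const Complex.continuous_re
  have key : EqOn riemannZeta₁
      (fun s => s - (s - 1) * s * mellin (fun x : ℝ => fractTail x⁻¹) s) U := by
    refine AnalyticOnNhd.eqOn_of_preconnected_of_eventuallyEq (𝕜 := ℂ) (z₀ := 2) ?_ ?_ ?_ ?_ ?_
    · exact fun z _ => differentiable_riemannZeta₁.analyticAt z
    · have hd : DifferentiableOn ℂ
          (fun s => s - (s - 1) * s * mellin (fun x : ℝ => fractTail x⁻¹) s) U := fun z hz => by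
        have := differentiableAt_mellin_fractTail_inv hz
        exact DifferentiableAt.differentiableWithinAt (by fun_prop)
      exact hd.analyticOnNhd hUo
    · exact (convex_halfSpace_re_gt (0 : ℝ)).isPreconnected
    · simp [hU]
    · have : {z : ℂ | 1 < z.re} ∈ 𝓝 (2 : ℂ) :=
        (isOpen_lt continuous_const Complex.continuous_re).mem_nhds (by simp)
      filter_upwards [this] with z hz
      have hz1 : z ≠ 1 := by rintro rfl; simp at hz
      have hz2 : z - 1 ≠ 0 := sub_ne_zero.2 hz1
      have a := riemannZeta_eq_inv_sub_mul hz1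
      rw [riemannZeta_eq_of_one_lt_re hz] at a
      field_simp at a
      rw [← a]
      ring_nf
  have hz2 : s - 1 ≠ 0 := sub_ne_zero.2 h1
  rw [riemannZeta_eq_inv_sub_mul h1, key hs]
  field_simp

theorem mellin_fract_inv {s : ℂ} (h0 : 0 < s.re) (h1 : s.re < 1) :
    mellin (fun x : ℝ => ((Int.fract x⁻¹ : ℝ) : ℂ)) s = -riemannZeta s / s := by
  have hs1 : s ≠ 1 := by rintro rfl; simp at h1
  have hs0 : s ≠ 0 := by rintro rfl; simp at h0
  have hd : s - 1 ≠ 0 := sub_ne_zero.2 hs1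
  have i2 : IntegrableOn (fun t : ℝ => (t : ℂ) ^ (s - 2)) (Ioi 1) :=
    integrableOn_Ioi_cpow_of_lt (by simp; linarith) one_pos
  have e : mellin (fun x : ℝ => ((Int.fract x⁻¹ : ℝ) : ℂ)) s
      = ∫ t in Ioi (0 : ℝ), ((t : ℂ) ^ (s - 1) • fractTail t⁻¹
        + indicator (Ioi 1) (fun t : ℝ => (t : ℂ) ^ (s - 2)) t) := by
    refine setIntegral_congr_fun measurableSet_Ioi fun t ht => ?_
    have ht0 : (0 : ℝ) < t := ht
    have htc : (t : ℂ) ≠ 0 := by exact_mod_cast ht0.ne'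
    rcases le_or_gt t 1 with h | h
    · simp only
      rw [fractTail_inv_of_le ht0 h, indicator_of_notMem (by simpa using h), add_zero]
    · simp only
      rw [fractTail_inv_of_gt h, indicator_of_mem (show t ∈ Ioi (1 : ℝ) from h), smul_zero, zero_add,
        Int.fract_eq_self.2 ⟨by positivity, inv_lt_one_of_one_lt₀ h⟩,
        show s - 1 = (s - 2) + 1 by ring, Complex.cpow_add _ _ htc, Complex.cpow_one, smul_eq_mul]
      push_cast
      field_simp
  have i3 : IntegrableOn (indicator (Ioi 1) (fun t : ℝ => (t : ℂ) ^ (s - 2))) (Ioi 0) :=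
    (i2.integrable_indicator measurableSet_Ioi).integrableOn
  rw [e, integral_add (mellinConvergent_fractTail_inv h0) i3,
    setIntegral_indicator measurableSet_Ioi, Ioi_inter_Ioi,
    show (0 : ℝ) ⊔ 1 = 1 by simp, integral_Ioi_cpow_of_lt (by simp; linarith) one_pos,
    riemannZeta_eq_of_re_pos h0 hs1]
  change mellin (fun x : ℝ => fractTail x⁻¹) s + _ = _
  have hd' : s - 2 + 1 ≠ 0 := by
    intro h; apply hd; linear_combination h
  simp only [Complex.ofReal_one, Complex.one_cpow]
  rw [show s - 2 + 1 = s - 1 by ring]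
  field_simp
  ring

/-- The function `u ↦ {e^u} e^{-u/2}`, whose Fourier transform is `-ζ(s)/s` on the critical line. -/
def fractKernel (u : ℝ) : ℝ := Int.fract (Real.exp u) * Real.exp (-u / 2)

theorem fourier_fractKernel (ξ : ℝ) :
    𝓕 (fun u => (fractKernel u : ℂ)) ξ
      = -riemannZeta (1 / 2 + Complex.I * ((2 * Real.pi * ξ : ℝ) : ℂ))
        / (1 / 2 + Complex.I * ((2 * Real.pi * ξ : ℝ) : ℂ)) := by
  have hre : (1 / 2 + Complex.I * ((2 * Real.pi * ξ : ℝ) : ℂ)).re = 1 / 2 := by simp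
  have him : (1 / 2 + Complex.I * ((2 * Real.pi * ξ : ℝ) : ℂ)).im = 2 * Real.pi * ξ := by simp
  rw [← mellin_fract_inv (by rw [hre]; norm_num) (by rw [hre]; norm_num), mellin_eq_fourier,
    hre, him, mul_div_cancel_left₀ _ (by positivity)]
  refine congrFun (congrArg 𝓕 (funext fun u => ?_)) ξ
  rw [fractKernel, Complex.real_smul, ← Complex.ofReal_mul, ← Real.exp_neg, neg_neg, mul_comm]
  congr 3
  ring

theorem measurable_fractKernel : Measurable fractKernel := by
  unfold fractKernel
  exact (measurable_fract.comp Real.measurable_exp).mul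
    (Real.measurable_exp.comp (measurable_id.neg.div_const 2))

theorem fractKernel_nonneg (u : ℝ) : 0 ≤ fractKernel u :=
  mul_nonneg (Int.fract_nonneg _) (Real.exp_pos _).le

theorem fractKernel_of_neg {u : ℝ} (hu : u < 0) : fractKernel u = Real.exp (u / 2) := by
  rw [fractKernel, Int.fract_eq_self.2 ⟨(Real.exp_pos u).le, Real.exp_lt_one_iff.2 hu⟩, ← Real.exp_add]
  congr 1
  ring

theorem fractKernel_le (u : ℝ) : fractKernel u ≤ Real.exp (-|u| / 2) := by
  rcases lt_or_ge u 0 with h | h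
  · rw [fractKernel_of_neg h, abs_of_neg h, neg_neg]
  · rw [fractKernel, abs_of_nonneg h]
    exact mul_le_of_le_one_left (Real.exp_pos _).le (Int.fract_lt_one _).le

theorem integrable_exp_neg_abs_div_two : Integrable fun u : ℝ => Real.exp (-|u| / 2) := by
  rw [← integrableOn_univ, ← Iic_union_Ioi (a := (0 : ℝ)), integrableOn_union]
  constructor
  · refine (integrableOn_exp_mul_Iic (a := 1 / 2) (by norm_num) 0).congr_fun
      (fun u hu => ?_) measurableSet_Iic
    simp only [abs_of_nonpos (show u ≤ 0 from hu)]
    congr 1; ring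
  · refine (integrableOn_exp_mul_Ioi (a := -1 / 2) (by norm_num) 0).congr_fun
      (fun u hu => ?_) measurableSet_Ioi
    simp only [abs_of_pos (show 0 < u from hu)]
    congr 1; ring

theorem integrable_fractKernel : Integrable fractKernel := by
  refine integrable_exp_neg_abs_div_two.mono' measurable_fractKernel.aestronglyMeasurable ?_
  filter_upwards with u
  rw [Real.norm_of_nonneg (fractKernel_nonneg u)]
  exact fractKernel_le u

theorem memLp_fractKernel : MemLp fractKernel 2 := by
  rw [memLp_two_iff_integrable_sq measurable_fractKernel.aestronglyMeasurable]
  refine integrable_exp_neg_abs_div_two.mono' (measurable_fractKernel.pow_const 2).aestronglyMeasurable ?_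
  filter_upwards with u
  rw [Real.norm_of_nonneg (sq_nonneg _)]
  have h0 := fractKernel_nonneg u
  have h1 := fractKernel_le u
  have h2 : Real.exp (-|u| / 2) ≤ 1 := Real.exp_le_one_iff.2 (by have := abs_nonneg u; linarith)
  nlinarith

/-- The difference `K(u + δ) - K(u)` of the kernel. -/
def fractDiff (δ u : ℝ) : ℝ := fractKernel (u + δ) - fractKernel u

theorem integrable_fractDiff (δ : ℝ) : Integrable (fractDiff δ) :=
  (integrable_fractKernel.comp_add_right δ).sub integrable_fractKernel

theorem memLp_fractDiff (δ : ℝ) : MemLp (fractDiff δ) 2 :=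
  (memLp_fractKernel.comp_measurePreserving (measurePreserving_add_right volume δ)).sub
    memLp_fractKernel

theorem fractDiff_sq (δ u : ℝ) :
    fractDiff δ u ^ 2 = Real.exp (-u)
      * (Real.exp (-δ / 2) * Int.fract (Real.exp (u + δ)) - Int.fract (Real.exp u)) ^ 2 := by
  have e1 : Real.exp (-(u + δ) / 2) = Real.exp (-u / 2) * Real.exp (-δ / 2) := by
    rw [← Real.exp_add]; congr 1; ring
  have e2 : Real.exp (-u) = Real.exp (-u / 2) ^ 2 := by
    rw [← Real.exp_nat_mul]; congr 1; push_cast; ring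
  rw [fractDiff, fractKernel, fractKernel, e1, e2]
  ring

/-- `⌊e^u⌋ e^{-u}`. -/
def floorRatio (u : ℝ) : ℝ := (⌊Real.exp u⌋ : ℝ) * Real.exp (-u)

theorem measurable_floorRatio : Measurable floorRatio := by
  unfold floorRatio
  refine Measurable.mul ?_ (Real.measurable_exp.comp measurable_neg)
  exact (measurable_from_top (f := fun n : ℤ => (n : ℝ))).comp
    (Int.measurable_floor.comp Real.measurable_exp)

theorem floorRatio_nonneg (u : ℝ) : 0 ≤ floorRatio u :=
  mul_nonneg (by exact_mod_cast Int.floor_nonneg.2 (Real.exp_pos u).le) (Real.exp_pos _).le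

theorem floorRatio_le_one (u : ℝ) : floorRatio u ≤ 1 := by
  have h : Real.exp u * Real.exp (-u) = 1 := by rw [← Real.exp_add]; simp
  rw [← h]
  exact mul_le_mul_of_nonneg_right (Int.floor_le _) (Real.exp_pos _).le

theorem half_le_floorRatio {u : ℝ} (hu : 0 ≤ u) : 1 / 2 ≤ floorRatio u := by
  have h : Real.exp u * Real.exp (-u) = 1 := by rw [← Real.exp_add]; simp
  have h1 : (1 : ℝ) ≤ ⌊Real.exp u⌋ := by
    exact_mod_cast Int.le_floor.2 (by simpa using Real.one_le_exp hu)
  have h2 := Int.lt_floor_add_one (Real.exp u)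
  have h3 : Real.exp u / 2 ≤ ⌊Real.exp u⌋ := by linarith
  have := mul_le_mul_of_nonneg_right h3 (Real.exp_pos (-u)).le
  unfold floorRatio
  linarith

theorem intervalIntegrable_floorRatio (a b : ℝ) : IntervalIntegrable floorRatio volume a b := by
  refine (intervalIntegrable_const (c := (1 : ℝ))).mono_fun
    measurable_floorRatio.aestronglyMeasurable ?_
  filter_upwards with u
  rw [Real.norm_of_nonneg (floorRatio_nonneg u)]
  simpa using floorRatio_le_one u

/-- The normalised number of integers in `(e^u, e^{u + δ}]`. -/
def jump (δ u : ℝ) : ℝ :=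
  ((⌊Real.exp (u + δ)⌋ : ℝ) - ⌊Real.exp u⌋) * Real.exp (-u)

theorem jump_eq (δ u : ℝ) : jump δ u = Real.exp δ * floorRatio (u + δ) - floorRatio u := by
  have : Real.exp (-u) = Real.exp δ * Real.exp (-(u + δ)) := by
    rw [← Real.exp_add]; congr 1; ring
  rw [jump, floorRatio, floorRatio]
  nth_rewrite 1 [sub_mul, this]
  ring

theorem jump_nonneg {δ : ℝ} (hδ : 0 ≤ δ) (u : ℝ) : 0 ≤ jump δ u := by
  refine mul_nonneg (sub_nonneg.2 ?_) (Real.exp_pos _).le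
  exact_mod_cast Int.floor_mono (Real.exp_le_exp.2 (by linarith))

theorem intervalIntegrable_jump (δ a b : ℝ) : IntervalIntegrable (jump δ) volume a b := by
  have h := ((intervalIntegrable_floorRatio (a + δ) (b + δ)).comp_add_right δ)
  simp only [add_sub_cancel_right] at h
  refine ((h.const_mul (Real.exp δ)).sub (intervalIntegrable_floorRatio a b)).congr ?_
  exact fun u _ => (jump_eq δ u).symm

theorem integral_jump (δ a b : ℝ) :
    ∫ u in a..b, jump δ u = (Real.exp δ - 1) * (∫ u in a..b, floorRatio u)
      + Real.exp δ * ((∫ u in b..(b + δ), floorRatio u) - ∫ u in a..(a + δ), floorRatio u) := by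
  have h := ((intervalIntegrable_floorRatio (a + δ) (b + δ)).comp_add_right δ)
  simp only [add_sub_cancel_right] at h
  simp only [jump_eq]
  rw [intervalIntegral.integral_sub (h.const_mul _) (intervalIntegrable_floorRatio a b),
    intervalIntegral.integral_const_mul, intervalIntegral.integral_comp_add_right]
  have e1 := intervalIntegral.integral_add_adjacent_intervals
    (intervalIntegrable_floorRatio a b) (intervalIntegrable_floorRatio b (b + δ))
  have e2 := intervalIntegral.integral_add_adjacent_intervals
    (intervalIntegrable_floorRatio a (a + δ)) (intervalIntegrable_floorRatio (a + δ) (b + δ))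
  linear_combination Real.exp δ * (e2 - e1)

theorem integral_floorRatio_le {a b : ℝ} (h : a ≤ b) : ∫ u in a..b, floorRatio u ≤ b - a := by
  have := intervalIntegral.integral_mono_on h (intervalIntegrable_floorRatio a b)
    (intervalIntegrable_const (c := (1 : ℝ))) (fun u _ => floorRatio_le_one u)
  simpa using this

theorem integral_floorRatio_nonneg {a b : ℝ} (h : a ≤ b) : 0 ≤ ∫ u in a..b, floorRatio u :=
  intervalIntegral.integral_nonneg h fun u _ => floorRatio_nonneg u

theorem le_integral_floorRatio {b : ℝ} (h : 0 ≤ b) : b / 2 ≤ ∫ u in (0 : ℝ)..b, floorRatio u := by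
  have := intervalIntegral.integral_mono_on h (intervalIntegrable_const (c := (1 / 2 : ℝ)))
    (intervalIntegrable_floorRatio 0 b) (fun u hu => half_le_floorRatio hu.1)
  rw [intervalIntegral.integral_const, smul_eq_mul] at this
  linarith

theorem exp_sub_one_le_two_mul {δ : ℝ} (h0 : 0 ≤ δ) (h1 : δ ≤ 1) : Real.exp δ - 1 ≤ 2 * δ := by
  have := Real.abs_exp_sub_one_le (x := δ) (by rwa [abs_of_nonneg h0])
  rw [abs_of_nonneg h0] at this
  exact (le_abs_self _).trans this

theorem integral_jump_le {δ b : ℝ} (h0 : 0 ≤ δ) (h1 : δ ≤ 1) (hb : 0 ≤ b) :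
    ∫ u in (-1 : ℝ)..b, jump δ u ≤ δ * (2 * b + 5) := by
  rw [integral_jump]
  have a1 := integral_floorRatio_le (show (-1 : ℝ) ≤ b by linarith)
  have a2 := integral_floorRatio_nonneg (show (-1 : ℝ) ≤ b by linarith)
  have a3 := integral_floorRatio_le (show b ≤ b + δ by linarith)
  have a4 := integral_floorRatio_nonneg (show (-1 : ℝ) ≤ -1 + δ by linarith)
  have e1 := exp_sub_one_le_two_mul h0 h1
  have e2 : 0 ≤ Real.exp δ - 1 := sub_nonneg.2 (Real.one_le_exp h0)
  have e3 : Real.exp δ ≤ 3 := by linarith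
  have b1 : (Real.exp δ - 1) * (∫ u in (-1 : ℝ)..b, floorRatio u) ≤ 2 * δ * (b + 1) := by
    apply mul_le_mul e1 (by linarith) a2 (by linarith)
  have b2 : Real.exp δ * ((∫ u in b..(b + δ), floorRatio u) - ∫ u in (-1 : ℝ)..(-1 + δ), floorRatio u)
      ≤ 3 * δ := by
    calc _ ≤ Real.exp δ * δ := mul_le_mul_of_nonneg_left (by linarith) (by linarith)
      _ ≤ 3 * δ := mul_le_mul_of_nonneg_right e3 h0
  linarith

theorem le_integral_jump {δ b : ℝ} (h0 : 0 ≤ δ) (h1 : δ ≤ 1) (hb : 0 ≤ b) :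
    δ * (b / 2 - 3) ≤ ∫ u in (0 : ℝ)..b, jump δ u := by
  rw [integral_jump]
  have a1 := le_integral_floorRatio hb
  have a3 := integral_floorRatio_nonneg (show b ≤ b + δ by linarith)
  have a4 := integral_floorRatio_le (show (0 : ℝ) ≤ 0 + δ by linarith)
  have e1 := exp_sub_one_le_two_mul h0 h1
  have e2 : δ ≤ Real.exp δ - 1 := by linarith [Real.add_one_le_exp δ]
  have e3 : Real.exp δ ≤ 3 := by linarith
  have b1 : δ * (b / 2) ≤ (Real.exp δ - 1) * (∫ u in (0 : ℝ)..b, floorRatio u) := by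
    apply mul_le_mul e2 a1 (by linarith) (by linarith)
  have b2 : -(3 * δ) ≤ Real.exp δ *
      ((∫ u in b..(b + δ), floorRatio u) - ∫ u in (0 : ℝ)..(0 + δ), floorRatio u) := by
    calc -(3 * δ) ≤ -(Real.exp δ * δ) := by nlinarith
      _ = Real.exp δ * (-δ) := by ring
      _ ≤ _ := mul_le_mul_of_nonneg_left (by linarith) (by linarith)
  linarith

theorem abs_scaled_fract_sub_le_one {δ : ℝ} (h0 : 0 ≤ δ) (x y : ℝ) :
    |Real.exp (-δ / 2) * Int.fract x - Int.fract y| ≤ 1 := by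
  have a := Int.fract_nonneg x
  have b := (Int.fract_lt_one x).le
  have c := Int.fract_nonneg y
  have d := (Int.fract_lt_one y).le
  have e : Real.exp (-δ / 2) ≤ 1 := Real.exp_le_one_iff.2 (by linarith)
  have e' := (Real.exp_pos (-δ / 2)).le
  rw [abs_le]
  constructor <;> nlinarith

theorem fractDiff_sq_le_exp {δ : ℝ} (h0 : 0 ≤ δ) (u : ℝ) : fractDiff δ u ^ 2 ≤ Real.exp (-u) := by
  rw [fractDiff_sq]
  refine mul_le_of_le_one_right (Real.exp_pos _).le ?_
  rw [sq_le_one_iff_abs_le_one]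
  exact abs_scaled_fract_sub_le_one h0 _ _

theorem fractDiff_sq_le_of_lt {δ : ℝ} (h0 : 0 ≤ δ) (h1 : δ ≤ 1) {u : ℝ} (hu : u < -1) :
    fractDiff δ u ^ 2 ≤ δ * Real.exp u := by
  have e : Real.exp ((u + δ) / 2) = Real.exp (u / 2) * Real.exp (δ / 2) := by
    rw [← Real.exp_add]; congr 1; ring
  have e2 : Real.exp u = Real.exp (u / 2) ^ 2 := by
    rw [← Real.exp_nat_mul]; congr 1; push_cast; ring
  rw [fractDiff, fractKernel_of_neg (by linarith), fractKernel_of_neg (by linarith), e, e2,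
    show Real.exp (u / 2) * Real.exp (δ / 2) - Real.exp (u / 2)
      = Real.exp (u / 2) * (Real.exp (δ / 2) - 1) by ring, mul_pow, mul_comm]
  refine mul_le_mul_of_nonneg_right ?_ (sq_nonneg _)
  have a := exp_sub_one_le_two_mul (δ := δ / 2) (by linarith) (by linarith)
  have b : 0 ≤ Real.exp (δ / 2) - 1 := sub_nonneg.2 (Real.one_le_exp (by linarith))
  nlinarith

theorem fractDiff_sq_le_jump {δ : ℝ} (h0 : 0 ≤ δ) (h1 : δ ≤ 1) {u : ℝ} (hu : -1 ≤ u) :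
    fractDiff δ u ^ 2 ≤ jump δ u + 5 * δ := by
  rw [fractDiff_sq]
  set E := Real.exp (-δ / 2) * Int.fract (Real.exp (u + δ)) - Int.fract (Real.exp u) with hE
  have hE1 : |E| ≤ 1 := abs_scaled_fract_sub_le_one h0 _ _
  have hsq : E ^ 2 ≤ |E| := by
    rw [← sq_abs]; nlinarith [abs_nonneg E]
  have hx : Real.exp (u + δ) = Real.exp u * Real.exp δ := Real.exp_add _ _
  have f1 := Int.floor_add_fract (Real.exp (u + δ))
  have f2 := Int.floor_add_fract (Real.exp u)
  have f3 := Int.fract_nonneg (Real.exp (u + δ))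
  have f4 := (Int.fract_lt_one (Real.exp (u + δ))).le
  have l1 : 1 - δ / 2 ≤ Real.exp (-δ / 2) := by linarith [Real.add_one_le_exp (-δ / 2)]
  have l2 : Real.exp (-δ / 2) ≤ 1 := Real.exp_le_one_iff.2 (by linarith)
  have m1 := exp_sub_one_le_two_mul h0 h1
  have m2 : 0 ≤ Real.exp δ - 1 := sub_nonneg.2 (Real.one_le_exp h0)
  have hj : (0 : ℝ) ≤ (⌊Real.exp (u + δ)⌋ : ℝ) - ⌊Real.exp u⌋ := by
    refine sub_nonneg.2 ?_
    exact_mod_cast Int.floor_mono (Real.exp_le_exp.2 (by linarith))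
  have hpos := Real.exp_pos u
  have habs : |E| ≤ 2 * δ * Real.exp u + ((⌊Real.exp (u + δ)⌋ : ℝ) - ⌊Real.exp u⌋) + δ / 2 := by
    have k1 : 0 ≤ (1 - Real.exp (-δ / 2)) * Int.fract (Real.exp (u + δ)) :=
      mul_nonneg (by linarith) f3
    have k2 : (1 - Real.exp (-δ / 2)) * Int.fract (Real.exp (u + δ)) ≤ δ / 2 * 1 :=
      mul_le_mul (by linarith) f4 f3 (by linarith)
    have k3 : 0 ≤ Real.exp u * (Real.exp δ - 1) := mul_nonneg hpos.le m2
    have k4 : Real.exp u * (Real.exp δ - 1) ≤ Real.exp u * (2 * δ) :=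
      mul_le_mul_of_nonneg_left m1 hpos.le
    have k5 : E = Real.exp u * (Real.exp δ - 1)
        - ((⌊Real.exp (u + δ)⌋ : ℝ) - ⌊Real.exp u⌋)
        - (1 - Real.exp (-δ / 2)) * Int.fract (Real.exp (u + δ)) := by
      rw [hE]; rw [hx] at f1 ⊢; linarith
    rw [abs_le]
    constructor <;> linarith
  have h3 : Real.exp (-u) ≤ 3 := by
    have : Real.exp (-u) ≤ Real.exp 1 := Real.exp_le_exp.2 (by linarith)
    linarith [Real.exp_one_lt_d9]
  have hp := Real.exp_pos (-u)
  have hone : Real.exp (-u) * Real.exp u = 1 := by rw [← Real.exp_add]; simp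
  calc Real.exp (-u) * E ^ 2
      ≤ Real.exp (-u) * (2 * δ * Real.exp u + ((⌊Real.exp (u + δ)⌋ : ℝ) - ⌊Real.exp u⌋) + δ / 2) :=
        mul_le_mul_of_nonneg_left (hsq.trans habs) hp.le
    _ = 2 * δ * (Real.exp (-u) * Real.exp u) + jump δ u + δ / 2 * Real.exp (-u) := by
        rw [jump]; ring
    _ ≤ _ := by rw [hone]; nlinarith

theorem jump_le_fractDiff_sq {δ : ℝ} (h0 : 0 ≤ δ) (h1 : δ ≤ 1) {u : ℝ}
    (hu : δ * Real.exp u ≤ 1 / 10) : jump δ u / 4 ≤ fractDiff δ u ^ 2 := by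
  rw [fractDiff_sq, jump]
  set E := Real.exp (-δ / 2) * Int.fract (Real.exp (u + δ)) - Int.fract (Real.exp u) with hE
  have hx : Real.exp (u + δ) = Real.exp u * Real.exp δ := Real.exp_add _ _
  have f1 := Int.floor_add_fract (Real.exp (u + δ))
  have f2 := Int.floor_add_fract (Real.exp u)
  have f3 := Int.fract_nonneg (Real.exp (u + δ))
  have f5 := Int.fract_lt_one (Real.exp u)
  have l2 : Real.exp (-δ / 2) ≤ 1 := Real.exp_le_one_iff.2 (by linarith)
  have m1 := exp_sub_one_le_two_mul h0 h1
  have hpos := Real.exp_pos u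
  have hstep : Real.exp (u + δ) - Real.exp u ≤ 1 / 5 := by rw [hx]; nlinarith
  have hkey : ((⌊Real.exp (u + δ)⌋ : ℝ) - ⌊Real.exp u⌋) / 4 ≤ E ^ 2 := by
    have hz : (⌊Real.exp (u + δ)⌋ : ℤ) ≤ ⌊Real.exp u⌋ + 1 := by
      have : (⌊Real.exp (u + δ)⌋ : ℝ) < ⌊Real.exp u⌋ + 2 := by linarith
      have : (⌊Real.exp (u + δ)⌋ : ℤ) < ⌊Real.exp u⌋ + 2 := by exact_mod_cast this
      linarith
    rcases hz.lt_or_eq with h | h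
    · have : (⌊Real.exp (u + δ)⌋ : ℝ) ≤ ⌊Real.exp u⌋ := by exact_mod_cast Int.lt_add_one_iff.1 h
      nlinarith [sq_nonneg E]
    · have hr : (⌊Real.exp (u + δ)⌋ : ℝ) = ⌊Real.exp u⌋ + 1 := by exact_mod_cast h
      have : E ≤ -(1 / 2) := by
        have : Real.exp (-δ / 2) * Int.fract (Real.exp (u + δ)) ≤ Int.fract (Real.exp (u + δ)) :=
          mul_le_of_le_one_left f3 l2
        rw [hE]; linarith
      nlinarith
  calc _ = Real.exp (-u) * (((⌊Real.exp (u + δ)⌋ : ℝ) - ⌊Real.exp u⌋) / 4) := by ring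
    _ ≤ _ := mul_le_mul_of_nonneg_left hkey (Real.exp_pos _).le

theorem lintegral_fractDiff_sq_le {δ : ℝ} (h0 : 0 < δ) (h1 : δ ≤ 1) :
    ∫⁻ u, ENNReal.ofReal (fractDiff δ u ^ 2) ≤ ENNReal.ofReal (δ * (7 * Real.log δ⁻¹ + 12)) := by
  set U := Real.log δ⁻¹ with hU
  have hU0 : 0 ≤ U := Real.log_nonneg ((one_le_inv₀ h0).2 h1)
  have hsplit : (univ : Set ℝ) ⊆ Iic (-1) ∪ (Ioc (-1) U ∪ Ioi U) := by
    intro x _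
    rcases le_or_gt x (-1) with h | h
    · exact Or.inl h
    · rcases le_or_gt x U with h' | h'
      · exact Or.inr (Or.inl ⟨h, h'⟩)
      · exact Or.inr (Or.inr h')
  have a1 : ∫⁻ u in Iic (-1), ENNReal.ofReal (fractDiff δ u ^ 2) ≤ ENNReal.ofReal δ := by
    rw [setLIntegral_congr Iio_ae_eq_Iic.symm]
    calc _ ≤ ∫⁻ u in Iio (-1), ENNReal.ofReal (δ * Real.exp u) :=
          setLIntegral_mono' measurableSet_Iio
            fun u hu => ENNReal.ofReal_le_ofReal (fractDiff_sq_le_of_lt h0.le h1 hu)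
      _ ≤ ∫⁻ u in Iic (-1), ENNReal.ofReal (δ * Real.exp u) :=
          lintegral_mono_set Iio_subset_Iic_self
      _ = ENNReal.ofReal (∫ u in Iic (-1), δ * Real.exp u) :=
          (ofReal_integral_eq_lintegral_ofReal (integrableOn_exp_Iic _ |>.const_mul δ)
            (Eventually.of_forall fun u => by positivity)).symm
      _ ≤ _ := by
          rw [integral_const_mul, integral_exp_Iic]
          refine ENNReal.ofReal_le_ofReal (mul_le_of_le_one_right h0.le ?_)
          exact Real.exp_le_one_iff.2 (by norm_num)
  have a2 : ∫⁻ u in Ioc (-1) U, ENNReal.ofReal (fractDiff δ u ^ 2)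
      ≤ ENNReal.ofReal (δ * (7 * U + 10)) := by
    have hle : (-1 : ℝ) ≤ U := by linarith
    have hi := (intervalIntegrable_jump δ (-1) U).add
      (intervalIntegrable_const (c := 5 * δ) (μ := volume))
    calc _ ≤ ∫⁻ u in Ioc (-1) U, ENNReal.ofReal (jump δ u + 5 * δ) :=
          setLIntegral_mono' measurableSet_Ioc
            fun u hu => ENNReal.ofReal_le_ofReal (fractDiff_sq_le_jump h0.le h1 hu.1.le)
      _ = ENNReal.ofReal (∫ u in Ioc (-1) U, (jump δ u + 5 * δ)) :=
          (ofReal_integral_eq_lintegral_ofReal hi.1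
            (Eventually.of_forall fun u => add_nonneg (jump_nonneg h0.le u) (by positivity))).symm
      _ ≤ _ := by
          rw [← intervalIntegral.integral_of_le hle,
            intervalIntegral.integral_add (intervalIntegrable_jump _ _ _) intervalIntegrable_const,
            intervalIntegral.integral_const]
          refine ENNReal.ofReal_le_ofReal ?_
          have := integral_jump_le h0.le h1 hU0
          rw [smul_eq_mul]
          linarith
  have a3 : ∫⁻ u in Ioi U, ENNReal.ofReal (fractDiff δ u ^ 2) ≤ ENNReal.ofReal δ := by
    calc _ ≤ ∫⁻ u in Ioi U, ENNReal.ofReal (Real.exp (-u)) :=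
          lintegral_mono fun u => ENNReal.ofReal_le_ofReal (fractDiff_sq_le_exp h0.le u)
      _ = ENNReal.ofReal (∫ u in Ioi U, Real.exp (-u)) :=
          (ofReal_integral_eq_lintegral_ofReal (integrableOn_exp_neg_Ioi U)
            (Eventually.of_forall fun u => by positivity)).symm
      _ ≤ _ := by
          rw [integral_exp_neg_Ioi, hU, Real.exp_neg, Real.exp_log (inv_pos.2 h0), inv_inv]
  calc _ = ∫⁻ u in univ, ENNReal.ofReal (fractDiff δ u ^ 2) := by simp
    _ ≤ ∫⁻ u in Iic (-1) ∪ (Ioc (-1) U ∪ Ioi U), ENNReal.ofReal (fractDiff δ u ^ 2) :=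
        lintegral_mono_set hsplit
    _ ≤ ENNReal.ofReal δ + (ENNReal.ofReal (δ * (7 * U + 10)) + ENNReal.ofReal δ) :=
        (lintegral_union_le _ _ _).trans
          (add_le_add a1 ((lintegral_union_le _ _ _).trans (add_le_add a2 a3)))
    _ = _ := by
        rw [← ENNReal.ofReal_add (by positivity) (by positivity),
          ← ENNReal.ofReal_add (by positivity) (by positivity)]
        congr 1
        ring

theorem le_lintegral_fractDiff_sq {δ : ℝ} (h0 : 0 < δ) (h1 : δ ≤ 1) :
    ENNReal.ofReal (δ * (Real.log δ⁻¹ / 8 - 2)) ≤ ∫⁻ u, ENNReal.ofReal (fractDiff δ u ^ 2) := by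
  set U := Real.log δ⁻¹ - 3 with hU
  rcases lt_or_ge U 0 with hneg | hU0
  · rw [ENNReal.ofReal_of_nonpos]
    · exact zero_le
    · nlinarith
  have hexp : ∀ u ≤ U, δ * Real.exp u ≤ 1 / 10 := by
    intro u hu
    have : Real.exp u ≤ Real.exp (Real.log δ⁻¹ - 3) := Real.exp_le_exp.2 hu
    rw [Real.exp_sub, Real.exp_log (inv_pos.2 h0)] at this
    have e3 : (10 : ℝ) ≤ Real.exp 3 := by
      have e : Real.exp 3 = Real.exp 1 ^ 3 := by rw [← Real.exp_nat_mul]; norm_num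
      have := Real.exp_one_gt_d9
      rw [e]
      have : (2.7 : ℝ) ≤ Real.exp 1 := by linarith
      calc (10 : ℝ) ≤ 2.7 ^ 3 := by norm_num
        _ ≤ _ := pow_le_pow_left₀ (by norm_num) this 3
    calc δ * Real.exp u ≤ δ * (δ⁻¹ / Real.exp 3) := mul_le_mul_of_nonneg_left this h0.le
      _ = 1 / Real.exp 3 := by field_simp
      _ ≤ _ := one_div_le_one_div_of_le (by norm_num) e3
  calc _ ≤ ENNReal.ofReal (∫ u in Ioc 0 U, jump δ u / 4) := by
        rw [← intervalIntegral.integral_of_le hU0, intervalIntegral.integral_div]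
        refine ENNReal.ofReal_le_ofReal ?_
        have := le_integral_jump h0.le h1 hU0
        have hh : δ * (Real.log δ⁻¹ / 8 - 2) ≤ δ * (U / 2 - 3) / 4 := by
          rw [hU]; nlinarith
        linarith
    _ = ∫⁻ u in Ioc 0 U, ENNReal.ofReal (jump δ u / 4) :=
        ofReal_integral_eq_lintegral_ofReal ((intervalIntegrable_jump δ 0 U).1.div_const 4)
          (Eventually.of_forall fun u => div_nonneg (jump_nonneg h0.le u) (by norm_num))
    _ ≤ ∫⁻ u in Ioc 0 U, ENNReal.ofReal (fractDiff δ u ^ 2) :=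
        setLIntegral_mono' measurableSet_Ioc fun u hu =>
          ENNReal.ofReal_le_ofReal (jump_le_fractDiff_sq h0.le h1 (hexp u hu.2))
    _ ≤ _ := setLIntegral_le_lintegral _ _

theorem hardyZSq_eq (t : ℝ) : hardyZSq t = ‖riemannZeta (1 / 2 + Complex.I * (t : ℂ))‖ ^ 2 := by
  rw [hardyZSq, hardyZ, norm_mul, mul_comm Complex.I, Complex.norm_exp_ofReal_mul_I, one_mul]

theorem half_add_I_mul_ne_one (t : ℝ) : (1 / 2 + Complex.I * (t : ℂ)) ≠ 1 := by
  intro h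
  have := congrArg Complex.re h
  norm_num at this

theorem continuous_hardyZSq : Continuous hardyZSq := by
  have : hardyZSq = fun t : ℝ => ‖riemannZeta (1 / 2 + Complex.I * (t : ℂ))‖ ^ 2 :=
    funext hardyZSq_eq
  rw [this]
  refine (Continuous.norm ?_).pow 2
  rw [continuous_iff_continuousAt]
  intro t
  exact (differentiableAt_riemannZeta (half_add_I_mul_ne_one t)).continuousAt.comp
    (f := fun t : ℝ => (1 / 2 + Complex.I * (t : ℂ))) (by fun_prop)

theorem hardyZSq_nonneg (t : ℝ) : 0 ≤ hardyZSq t := sq_nonneg _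

theorem hardyZSq_neg (t : ℝ) : hardyZSq (-t) = hardyZSq t := by
  have : (1 / 2 + Complex.I * ((-t : ℝ) : ℂ))
      = (starRingEnd ℂ) (1 / 2 + Complex.I * (t : ℂ)) := by
    simp [map_ofNat (starRingEnd ℂ) 2]
  rw [hardyZSq_eq, hardyZSq_eq, this, riemannZeta_conj, Complex.norm_conj]

/-- The spectral density of `fractDiff δ`. -/
def spectralDensity (δ t : ℝ) : ℝ :=
  hardyZSq t * ((2 - 2 * Real.cos (δ * t)) / (1 / 4 + t ^ 2))

theorem continuous_spectralDensity (δ : ℝ) : Continuous (spectralDensity δ) := by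
  unfold spectralDensity
  refine continuous_hardyZSq.mul (Continuous.div (by fun_prop) (by fun_prop) fun t => ?_)
  positivity

theorem norm_fourier_fractDiff_sq (δ ξ : ℝ) :
    ‖𝓕 (fun u => (fractDiff δ u : ℂ)) ξ‖ ^ 2 = spectralDensity δ (2 * Real.pi * ξ) := by
  have hK : Integrable fun u => (fractKernel u : ℂ) := integrable_fractKernel.ofReal
  have e1 : 𝓕 (fun u => (fractKernel (u + δ) : ℂ)) ξ
      = (Real.fourierChar (δ * ξ) : ℂ) * 𝓕 (fun u => (fractKernel u : ℂ)) ξ := by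
    have := congrFun (VectorFourier.fourierIntegral_comp_add_right Real.fourierChar volume (innerₗ ℝ)
      (fun u => (fractKernel u : ℂ)) δ) ξ
    refine Eq.trans this ?_
    simp only [innerₗ_apply_apply, RCLike.inner_apply, conj_trivial, Circle.smul_def, smul_eq_mul]
    rw [mul_comm ξ δ]
    rfl
  have e2 : 𝓕 (fun u => (fractDiff δ u : ℂ)) ξ
      = (Real.fourierChar (δ * ξ) : ℂ) * 𝓕 (fun u => (fractKernel u : ℂ)) ξ
        - 𝓕 (fun u => (fractKernel u : ℂ)) ξ := by
    rw [← e1]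
    simp only [Real.fourier_eq']
    rw [← integral_sub]
    · congr 1
      ext u
      simp only [fractDiff, Complex.ofReal_sub, smul_eq_mul]
      ring
    · have := (Real.fourierIntegral_convergent_iff (μ := volume)
        (f := fun u => (fractKernel (u + δ) : ℂ)) ξ).2 (hK.comp_add_right δ)
      simpa [Real.fourierChar_apply', Circle.smul_def, mul_comm, mul_left_comm, Complex.exp_neg] using this
    · have := (Real.fourierIntegral_convergent_iff (μ := volume)
        (f := fun u => (fractKernel u : ℂ)) ξ).2 hK
      simpa [Real.fourierChar_apply', Circle.smul_def, mul_comm, mul_left_comm, Complex.exp_neg] using this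
  have hchar : ‖(Real.fourierChar (δ * ξ) : ℂ) - 1‖ ^ 2
      = 2 - 2 * Real.cos (δ * (2 * Real.pi * ξ)) := by
    rw [Real.fourierChar_apply, ← Complex.normSq_eq_norm_sq, Complex.exp_mul_I,
      ← Complex.ofReal_cos, ← Complex.ofReal_sin, Complex.normSq_apply]
    simp only [Complex.sub_re, Complex.add_re, Complex.ofReal_re, Complex.mul_re, Complex.I_re,
      Complex.sub_im, Complex.add_im, Complex.ofReal_im, Complex.mul_im, Complex.I_im,
      Complex.one_re, Complex.one_im]
    have h := Real.sin_sq_add_cos_sq (2 * Real.pi * (δ * ξ))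
    rw [show δ * (2 * Real.pi * ξ) = 2 * Real.pi * (δ * ξ) by ring]
    linear_combination h
  have hden : ‖(1 / 2 + Complex.I * ((2 * Real.pi * ξ : ℝ) : ℂ))‖ ^ 2
      = 1 / 4 + (2 * Real.pi * ξ) ^ 2 := by
    rw [← Complex.normSq_eq_norm_sq, Complex.normSq_apply]
    simp only [Complex.add_re, Complex.add_im, Complex.mul_re, Complex.mul_im, Complex.I_re,
      Complex.I_im, Complex.ofReal_re, Complex.ofReal_im]
    norm_num
    ring
  rw [e2, ← sub_one_mul, norm_mul, mul_pow, hchar, fourier_fractKernel, norm_div, norm_neg, div_pow,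
    hden, spectralDensity, hardyZSq_eq]
  ring

theorem lintegral_comp_const_mul {g : ℝ → ℝ≥0∞} (hg : Measurable g) {c : ℝ} (hc : 0 < c) :
    ∫⁻ x, g (c * x) = ENNReal.ofReal c⁻¹ * ∫⁻ x, g x := by
  rw [← lintegral_map hg (measurable_const_mul c), Real.map_volume_mul_left hc.ne',
    lintegral_smul_measure, abs_of_pos (inv_pos.2 hc), smul_eq_mul]

theorem lintegral_eq_two_mul_Ioi {g : ℝ → ℝ≥0∞} (hg : Measurable g) (heven : ∀ t, g (-t) = g t) :
    ∫⁻ t, g t = 2 * ∫⁻ t in Ioi 0, g t := by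
  have h1 : ∫⁻ t in Iio 0, g t = ∫⁻ t in Ioi 0, g t := by
    have := (Measure.measurePreserving_neg (volume : Measure ℝ)).setLIntegral_comp_preimage
      (measurableSet_Iio (a := (0 : ℝ))) hg
    rw [← this]
    have hs : (Neg.neg ⁻¹' Iio (0 : ℝ)) = Ioi 0 := by ext; simp
    rw [hs]
    simp only [heven]
  rw [← lintegral_add_compl g (measurableSet_Ioi (a := (0 : ℝ))), compl_Ioi,
    setLIntegral_congr Iio_ae_eq_Iic.symm, h1, two_mul]

theorem lintegral_fractDiff_sq (δ : ℝ) :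
    ∫⁻ t in Ioi 0, ENNReal.ofReal (spectralDensity δ t)
      = ENNReal.ofReal Real.pi * ∫⁻ u, ENNReal.ofReal (fractDiff δ u ^ 2) := by
  have hm : Measurable fun t => ENNReal.ofReal (spectralDensity δ t) :=
    (continuous_spectralDensity δ).measurable.ennreal_ofReal
  have hp := lintegral_enorm_fourier_sq (integrable_fractDiff δ).ofReal (memLp_fractDiff δ).ofReal
  have e1 : ∀ ξ : ℝ, ‖𝓕 (fun u => (fractDiff δ u : ℂ)) ξ‖ₑ ^ 2
      = ENNReal.ofReal (spectralDensity δ (2 * Real.pi * ξ)) := fun ξ => by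
    rw [← norm_fourier_fractDiff_sq, ENNReal.ofReal_pow (norm_nonneg _), ofReal_norm]
  have e2 : ∀ u : ℝ, ‖(fractDiff δ u : ℂ)‖ₑ ^ 2 = ENNReal.ofReal (fractDiff δ u ^ 2) := fun u => by
    rw [← ofReal_norm, ← ENNReal.ofReal_pow (norm_nonneg _), Complex.norm_real, Real.norm_eq_abs,
      sq_abs]
  have e3 : ∫⁻ ξ, ‖𝓕 (fun u => (fractDiff δ u : ℂ)) ξ‖ₑ ^ 2
      = ∫⁻ u, ‖(fractDiff δ u : ℂ)‖ₑ ^ 2 := hp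
  simp only [e1, e2] at e3
  rw [lintegral_comp_const_mul hm (by positivity : (0 : ℝ) < 2 * Real.pi),
    lintegral_eq_two_mul_Ioi hm] at e3
  · rw [← e3, ← mul_assoc, ← mul_assoc, ← ENNReal.ofReal_mul Real.pi_pos.le,
      show (2 : ℝ≥0∞) = ENNReal.ofReal 2 by simp,
      ← ENNReal.ofReal_mul (by positivity)]
    have : Real.pi * (2 * Real.pi)⁻¹ * 2 = 1 := by field_simp
    rw [this, ENNReal.ofReal_one, one_mul]
  · intro t
    simp only [spectralDensity, hardyZSq_neg, mul_neg, Real.cos_neg, neg_sq]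

/-- The measure `Z(t)² dt` on `(0, ∞)`. -/
def hardyMeasure : Measure ℝ :=
  (volume.restrict (Ioi 0)).withDensity fun t => ENNReal.ofReal (hardyZSq t)

theorem lintegral_hardyMeasure {g : ℝ → ℝ≥0∞} (hg : Measurable g) :
    ∫⁻ t, g t ∂hardyMeasure = ∫⁻ t in Ioi 0, ENNReal.ofReal (hardyZSq t) * g t := by
  rw [hardyMeasure, lintegral_withDensity_eq_lintegral_mul _
    continuous_hardyZSq.measurable.ennreal_ofReal hg]
  rfl

instance : SFinite hardyMeasure := by
  unfold hardyMeasure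
  infer_instance

theorem lintegral_hardyMeasure_oscillation (δ : ℝ) :
    ∫⁻ t, ENNReal.ofReal ((2 - 2 * Real.cos (δ * t)) / (1 / 4 + t ^ 2)) ∂hardyMeasure
      = ENNReal.ofReal Real.pi * ∫⁻ u, ENNReal.ofReal (fractDiff δ u ^ 2) := by
  rw [lintegral_hardyMeasure (by fun_prop), ← lintegral_fractDiff_sq]
  refine lintegral_congr fun t => ?_
  rw [spectralDensity, ENNReal.ofReal_mul (hardyZSq_nonneg t)]

theorem hardyMeasure_Iic_zero : hardyMeasure (Iic 0) = 0 := by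
  rw [hardyMeasure, withDensity_apply _ measurableSet_Iic, Measure.restrict_restrict measurableSet_Iic,
    inter_comm, Ioi_inter_Iic, Ioc_self, Measure.restrict_empty, lintegral_zero_measure]

theorem hardyMeasure_Iic {x : ℝ} (hx : 0 ≤ x) :
    hardyMeasure (Iic x) = ENNReal.ofReal (hardyLittlewood x) := by
  rw [hardyMeasure, withDensity_apply _ measurableSet_Iic, Measure.restrict_restrict measurableSet_Iic,
    inter_comm, Ioi_inter_Iic, hardyLittlewood, intervalIntegral.integral_of_le hx,
    ofReal_integral_eq_lintegral_ofReal]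
  · exact (continuous_hardyZSq.intervalIntegrable 0 x).1
  · exact Eventually.of_forall hardyZSq_nonneg

theorem hardyMeasure_Iic_lt_top (x : ℝ) : hardyMeasure (Iic x) < ⊤ := by
  refine (measure_mono (Iic_subset_Iic.2 (le_max_left x 0))).trans_lt ?_
  rw [hardyMeasure_Iic (le_max_right x 0)]
  exact ENNReal.ofReal_lt_top

theorem one_add_div_three_le_Gamma {ε : ℝ} (hε : 0 < ε) : 1 + ε / 3 ≤ Real.Gamma (2 + ε) := by
  have hd := Real.hasDerivAt_Gamma_nat 1
  norm_num at hd
  have h := Real.convexOn_Gamma.le_slope_of_hasDerivAt (x := 2) (y := 2 + ε)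
    (by simp) (by simp; linarith) (by linarith) hd
  rw [slope_def_field, Real.Gamma_two, add_sub_cancel_left, le_div_iff₀ hε] at h
  have := Real.eulerMascheroniConstant_lt_two_thirds
  nlinarith

theorem integral_rpow_mul_exp_neg_div {t ε : ℝ} (ht : 0 < t) (hε : 0 < ε) :
    ∫ x in Ioi (0 : ℝ), x ^ (-2 - ε) * Real.exp (-(t / x)) = t ^ (-1 - ε) * Real.Gamma (1 + ε) := by
  have h1 := integral_comp_rpow_Ioi (fun y : ℝ => y ^ (1 + ε - 1) * Real.exp (-(t * y)))
    (p := -1) (by norm_num)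
  rw [Real.integral_rpow_mul_exp_neg_mul_Ioi (by linarith) ht] at h1
  rw [show t ^ (-1 - ε) = (1 / t) ^ (1 + ε) by
    rw [one_div, Real.inv_rpow ht.le, ← Real.rpow_neg ht.le]; congr 1; ring, ← h1]
  refine setIntegral_congr_fun measurableSet_Ioi fun x hx => ?_
  have hx0 : (0 : ℝ) < x := hx
  simp only [smul_eq_mul, abs_neg, abs_one, one_mul]
  rw [← mul_assoc, ← Real.rpow_mul hx0.le, ← Real.rpow_add hx0, Real.rpow_neg_one, div_eq_mul_inv]
  congr 2
  ring

theorem ofReal_le_lintegral_rpow_mul_exp_neg_div {t ε : ℝ} (ht : 0 < t) (hε : 0 < ε) :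
    ENNReal.ofReal (t ^ (-1 - ε) * Real.Gamma (1 + ε))
      ≤ ∫⁻ x in Ioi (0 : ℝ), ENNReal.ofReal (x ^ (-2 - ε) * Real.exp (-(t / x))) := by
  have hpos : 0 < t ^ (-1 - ε) * Real.Gamma (1 + ε) :=
    mul_pos (Real.rpow_pos_of_pos ht _) (Real.Gamma_pos_of_pos (by linarith))
  have h := integral_rpow_mul_exp_neg_div ht hε
  have hi : IntegrableOn (fun x : ℝ => x ^ (-2 - ε) * Real.exp (-(t / x))) (Ioi 0) := by
    by_contra hc
    rw [integral_undef hc] at h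
    exact hpos.ne h
  rw [← h, ofReal_integral_eq_lintegral_ofReal hi]
  filter_upwards [ae_restrict_mem measurableSet_Ioi] with x hx
  exact mul_nonneg (Real.rpow_nonneg (le_of_lt hx) _) (Real.exp_pos _).le

theorem exp_neg_le_div_pow_four {v : ℝ} (hv : 0 < v) : Real.exp (-v) ≤ 24 / v ^ 4 := by
  have h := Real.pow_div_factorial_le_exp v hv.le 4
  rw [Real.exp_neg, le_div_iff₀ (by positivity), inv_mul_le_iff₀ (Real.exp_pos v)]
  have : (Nat.factorial 4 : ℝ) = 24 := by norm_num [Nat.factorial]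
  rw [this] at h
  linarith

theorem lintegral_Ioc_rpow_mul_exp_neg_div_le {a t ε : ℝ} (ha : 1 ≤ a) (ht : a < t) (h0 : 0 < ε)
    (h1 : ε ≤ 1) :
    ∫⁻ x in Ioc (0 : ℝ) a, ENNReal.ofReal (x ^ (-2 - ε) * Real.exp (-(t / x)))
      ≤ ENNReal.ofReal (24 * a ^ 3) * ENNReal.ofReal (t ^ (-1 - 1 / 2 : ℝ)) := by
  have ht0 : 0 < t := by linarith
  have hb : ∀ x ∈ Ioc (0 : ℝ) a, x ^ (-2 - ε) * Real.exp (-(t / x)) ≤ 24 * a ^ 2 * t ^ (-1 - 1 / 2 : ℝ) := by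
    intro x hx
    have hx0 := hx.1
    have e1 : x ^ (-2 - ε) * x ^ (4 : ℕ) = x ^ (2 - ε) := by
      rw [← Real.rpow_natCast, ← Real.rpow_add hx0]; congr 1; push_cast; ring
    have e2 : x ^ (2 - ε) ≤ a ^ (2 : ℕ) := by
      calc x ^ (2 - ε) ≤ a ^ (2 - ε) := Real.rpow_le_rpow hx0.le hx.2 (by linarith)
        _ ≤ a ^ (2 : ℝ) := Real.rpow_le_rpow_of_exponent_le ha (by linarith)
        _ = a ^ (2 : ℕ) := by norm_cast
    have e3 : (t ^ (4 : ℕ))⁻¹ ≤ t ^ (-1 - 1 / 2 : ℝ) := by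
      rw [← Real.rpow_natCast, ← Real.rpow_neg ht0.le]
      refine Real.rpow_le_rpow_of_exponent_le (by linarith) ?_
      norm_num
    calc x ^ (-2 - ε) * Real.exp (-(t / x)) ≤ x ^ (-2 - ε) * (24 / (t / x) ^ 4) :=
          mul_le_mul_of_nonneg_left (exp_neg_le_div_pow_four (by positivity))
            (Real.rpow_nonneg hx0.le _)
      _ = 24 * (x ^ (-2 - ε) * x ^ (4 : ℕ)) * (t ^ (4 : ℕ))⁻¹ := by
          field_simp
      _ ≤ 24 * a ^ 2 * t ^ (-1 - 1 / 2 : ℝ) := by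
          rw [e1]; gcongr
  calc _ ≤ ∫⁻ x in Ioc (0 : ℝ) a, ENNReal.ofReal (24 * a ^ 2 * t ^ (-1 - 1 / 2 : ℝ)) :=
        setLIntegral_mono' measurableSet_Ioc fun x hx => ENNReal.ofReal_le_ofReal (hb x hx)
    _ = _ := by
        rw [setLIntegral_const, Real.volume_Ioc, sub_zero, ← ENNReal.ofReal_mul (by positivity),
          ← ENNReal.ofReal_mul (by positivity)]
        congr 1; ring

theorem lintegral_Ioi_rpow {b ε : ℝ} (hb : 0 < b) (hε : 0 < ε) :
    ∫⁻ x in Ioi b, ENNReal.ofReal (x ^ (-2 - ε)) = ENNReal.ofReal (b ^ (-1 - ε) / (1 + ε)) := by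
  rw [← ofReal_integral_eq_lintegral_ofReal (integrableOn_Ioi_rpow_of_lt (by linarith) hb),
    integral_Ioi_rpow_of_lt (by linarith) hb]
  · congr 1
    rw [show -2 - ε + 1 = -(1 + ε) by ring, neg_div_neg_eq]
    congr 2; ring
  · filter_upwards [ae_restrict_mem measurableSet_Ioi] with x hx
    exact Real.rpow_nonneg (hb.trans hx).le _

theorem lintegral_Ioc_rpow {η ε : ℝ} (hη : 0 < η) (hε : 0 < ε) :
    ∫⁻ x in Ioc 0 η, ENNReal.ofReal (x ^ (-1 + ε)) = ENNReal.ofReal (η ^ ε / ε) := by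
  rw [← ofReal_integral_eq_lintegral_ofReal, ← intervalIntegral.integral_of_le hη.le,
    integral_rpow (Or.inl (by linarith))]
  · rw [show -1 + ε + 1 = ε by ring, Real.zero_rpow hε.ne', sub_zero]
  · exact (intervalIntegral.intervalIntegrable_rpow' (by linarith)).1
  · filter_upwards [ae_restrict_mem measurableSet_Ioc] with x hx
    exact Real.rpow_nonneg hx.1.le _

theorem lintegral_rpow_mul_measure_Iic_le (ν : Measure ℝ) [SFinite ν] {a ε : ℝ} (ha : 1 ≤ a)
    (hε : 0 < ε) :
    ∫⁻ x in Ioi a, ENNReal.ofReal (x ^ (-2 - ε)) * ν (Iic x)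
      ≤ ν (Iic a) + ENNReal.ofReal (1 / (1 + ε))
        * ∫⁻ t in Ioi a, ENNReal.ofReal (t ^ (-1 - ε)) ∂ν := by
  have hms : MeasurableSet {p : ℝ × ℝ | p.2 ≤ p.1} := measurableSet_le measurable_snd measurable_fst
  have e1 : ∀ x : ℝ, ENNReal.ofReal (x ^ (-2 - ε)) * ν (Iic x)
      = ∫⁻ t, ENNReal.ofReal (x ^ (-2 - ε)) * {p : ℝ × ℝ | p.2 ≤ p.1}.indicator 1 (x, t) ∂ν := by
    intro x
    have hm : Measurable fun t => {p : ℝ × ℝ | p.2 ≤ p.1}.indicator (1 : ℝ × ℝ → ℝ≥0∞) (x, t) :=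
      (measurable_one.indicator hms).comp measurable_prodMk_left
    rw [lintegral_const_mul _ hm]
    congr 1
    rw [← lintegral_indicator_one measurableSet_Iic]
    rfl
  simp only [e1]
  rw [lintegral_lintegral_swap]
  swap
  · refine Measurable.aemeasurable ?_
    refine Measurable.mul ?_ (measurable_one.indicator hms)
    exact (measurable_fst.pow_const _).ennreal_ofReal
  rw [← lintegral_add_compl _ (measurableSet_Iic (a := a)), compl_Iic]
  have hmono : ∀ t x : ℝ, ENNReal.ofReal (x ^ (-2 - ε)) * {p : ℝ × ℝ | p.2 ≤ p.1}.indicator 1 (x, t)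
      ≤ ENNReal.ofReal (x ^ (-2 - ε)) := by
    intro t x
    refine mul_le_of_le_one_right' ?_
    exact indicator_le_self _ _ _
  refine add_le_add ?_ ?_
  · calc _ ≤ ∫⁻ t in Iic a, 1 ∂ν := by
          refine lintegral_mono fun t => ?_
          refine (lintegral_mono (hmono t)).trans ?_
          rw [lintegral_Ioi_rpow (by linarith) hε, ← ENNReal.ofReal_one]
          refine ENNReal.ofReal_le_ofReal ?_
          rw [div_le_one (by linarith)]
          exact (Real.rpow_le_one_of_one_le_of_nonpos ha (by linarith)).trans (by linarith)
      _ = ν (Iic a) := by simp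
  · rw [← lintegral_const_mul _ (by fun_prop)]
    refine setLIntegral_mono' measurableSet_Ioi fun t ht => ?_
    have ht0 : 0 < t := by have : a < t := ht; linarith
    calc _ ≤ ∫⁻ x in Ioi a, (Ici t).indicator (fun x => ENNReal.ofReal (x ^ (-2 - ε))) x := by
          refine lintegral_mono fun x => ?_
          by_cases hx : t ≤ x
          · rw [indicator_of_mem (show x ∈ Ici t from hx)]
            exact hmono t x
          · rw [indicator_of_notMem (show (x, t) ∉ {p : ℝ × ℝ | p.2 ≤ p.1} from hx), mul_zero]
            exact zero_le
      _ ≤ ∫⁻ x, (Ici t).indicator (fun x => ENNReal.ofReal (x ^ (-2 - ε))) x :=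
          setLIntegral_le_lintegral _ _
      _ = ENNReal.ofReal (t ^ (-1 - ε) / (1 + ε)) := by
          rw [lintegral_indicator measurableSet_Ici, setLIntegral_congr Ioi_ae_eq_Ici.symm,
            lintegral_Ioi_rpow ht0 hε]
      _ = _ := by
          rw [← ENNReal.ofReal_mul (by positivity)]
          congr 1; ring

/-- If the Laplace transform of `ν` is bounded by its distribution function, up to a bounded
error, then its Mellin transform grows at most like `1 / ε` near its abscissa. -/
theorem exists_mellin_bound (ν : Measure ℝ) [SFinite ν] (hfin : ∀ x, ν (Iic x) < ⊤)
    {a C : ℝ} (ha : 1 ≤ a)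
    (hW : ∀ ε : ℝ, 0 < ε → ε ≤ 1 / 2 → ∫⁻ t in Ioi a, ENNReal.ofReal (t ^ (-1 - ε)) ∂ν < ⊤)
    (h : ∀ x, a < x → ∫⁻ t, ENNReal.ofReal (Real.exp (-(t / x))) ∂ν
      ≤ ν (Iic x) + ENNReal.ofReal C) :
    ∃ B : ℝ, 0 ≤ B ∧ ∀ ε : ℝ, 0 < ε → ε ≤ 1 / 2 →
      ∫⁻ t in Ioi a, ENNReal.ofReal (t ^ (-1 - ε)) ∂ν ≤ ENNReal.ofReal (B / ε) := by
  set W : ℝ → ℝ≥0∞ := fun ε => ∫⁻ t in Ioi a, ENNReal.ofReal (t ^ (-1 - ε)) ∂ν with hWdef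
  set D : ℝ≥0∞ := ν (Iic a) + ENNReal.ofReal C + ENNReal.ofReal (24 * a ^ 3) * W (1 / 2) with hD
  have hDtop : D ≠ ⊤ := by
    refine ENNReal.add_ne_top.2 ⟨ENNReal.add_ne_top.2 ⟨(hfin a).ne, ENNReal.ofReal_ne_top⟩, ?_⟩
    exact ENNReal.mul_ne_top ENNReal.ofReal_ne_top (hW _ (by norm_num) le_rfl).ne
  refine ⟨6 * D.toReal, by positivity, fun ε h0 h1 => ?_⟩
  have key : ENNReal.ofReal (Real.Gamma (1 + ε)) * W ε ≤ ENNReal.ofReal (1 / (1 + ε)) * W ε + D := by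
    calc ENNReal.ofReal (Real.Gamma (1 + ε)) * W ε
        = ∫⁻ t in Ioi a, ENNReal.ofReal (t ^ (-1 - ε) * Real.Gamma (1 + ε)) ∂ν := by
          rw [hWdef, ← lintegral_const_mul _ (by fun_prop)]
          refine lintegral_congr fun t => ?_
          rw [mul_comm (t ^ _), ENNReal.ofReal_mul (Real.Gamma_pos_of_pos (by linarith)).le]
      _ ≤ ∫⁻ t in Ioi a, ((∫⁻ x in Ioi a, ENNReal.ofReal (x ^ (-2 - ε) * Real.exp (-(t / x))))
            + ENNReal.ofReal (24 * a ^ 3) * ENNReal.ofReal (t ^ (-1 - 1 / 2 : ℝ))) ∂ν := by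
          refine setLIntegral_mono' measurableSet_Ioi fun t ht => ?_
          have ht' : a < t := ht
          refine (ofReal_le_lintegral_rpow_mul_exp_neg_div (by linarith) h0).trans ?_
          rw [← Ioc_union_Ioi_eq_Ioi (show (0 : ℝ) ≤ a by linarith), add_comm]
          exact (lintegral_union_le _ _ _).trans (add_le_add
            (lintegral_Ioc_rpow_mul_exp_neg_div_le ha ht' h0 (by linarith)) le_rfl)
      _ = (∫⁻ t in Ioi a, (∫⁻ x in Ioi a, ENNReal.ofReal (x ^ (-2 - ε) * Real.exp (-(t / x)))) ∂ν)
            + ENNReal.ofReal (24 * a ^ 3) * W (1 / 2) := by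
          rw [lintegral_add_right _ (by fun_prop), lintegral_const_mul _ (by fun_prop)]
      _ ≤ (∫⁻ t, (∫⁻ x in Ioi a, ENNReal.ofReal (x ^ (-2 - ε) * Real.exp (-(t / x)))) ∂ν)
            + ENNReal.ofReal (24 * a ^ 3) * W (1 / 2) := by
          gcongr
          exact Measure.restrict_le_self
      _ = (∫⁻ x in Ioi a, ∫⁻ t, ENNReal.ofReal (x ^ (-2 - ε) * Real.exp (-(t / x))) ∂ν)
            + ENNReal.ofReal (24 * a ^ 3) * W (1 / 2) := by
          rw [lintegral_lintegral_swap]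
          exact Measurable.aemeasurable (by fun_prop)
      _ ≤ (∫⁻ x in Ioi a, (ENNReal.ofReal (x ^ (-2 - ε)) * ν (Iic x)
            + ENNReal.ofReal C * ENNReal.ofReal (x ^ (-2 - ε))))
            + ENNReal.ofReal (24 * a ^ 3) * W (1 / 2) := by
          refine add_le_add (setLIntegral_mono' measurableSet_Ioi fun x hx => ?_) le_rfl
          have hx' : a < x := hx
          simp only [ENNReal.ofReal_mul (Real.rpow_nonneg (show 0 ≤ x by linarith) _)]
          rw [lintegral_const_mul _ (by fun_prop), mul_comm (ENNReal.ofReal C), ← mul_add]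
          gcongr
          exact h x hx'
      _ = (∫⁻ x in Ioi a, ENNReal.ofReal (x ^ (-2 - ε)) * ν (Iic x))
            + ENNReal.ofReal C * ENNReal.ofReal (a ^ (-1 - ε) / (1 + ε))
            + ENNReal.ofReal (24 * a ^ 3) * W (1 / 2) := by
          rw [lintegral_add_right _ (by fun_prop), lintegral_const_mul _ (by fun_prop),
            lintegral_Ioi_rpow (by linarith) h0]
      _ ≤ (ν (Iic a) + ENNReal.ofReal (1 / (1 + ε)) * W ε) + ENNReal.ofReal C
            + ENNReal.ofReal (24 * a ^ 3) * W (1 / 2) := by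
          gcongr
          · exact lintegral_rpow_mul_measure_Iic_le ν ha h0
          · refine mul_le_of_le_one_right' ?_
            rw [← ENNReal.ofReal_one]
            refine ENNReal.ofReal_le_ofReal ?_
            rw [div_le_one (by linarith)]
            exact (Real.rpow_le_one_of_one_le_of_nonpos ha (by linarith)).trans (by linarith)
      _ = _ := by rw [hD]; ring
  have hWtop : W ε ≠ ⊤ := (hW ε h0 h1).ne
  have hG : 0 < Real.Gamma (1 + ε) := Real.Gamma_pos_of_pos (by linarith)
  have keyr : Real.Gamma (1 + ε) * (W ε).toReal ≤ 1 / (1 + ε) * (W ε).toReal + D.toReal := by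
    have := ENNReal.toReal_mono
      (ENNReal.add_ne_top.2 ⟨ENNReal.mul_ne_top ENNReal.ofReal_ne_top hWtop, hDtop⟩) key
    rw [ENNReal.toReal_add (ENNReal.mul_ne_top ENNReal.ofReal_ne_top hWtop) hDtop,
      ENNReal.toReal_mul, ENNReal.toReal_mul, ENNReal.toReal_ofReal hG.le,
      ENNReal.toReal_ofReal (by positivity)] at this
    exact this
  have hG2 : Real.Gamma (2 + ε) = (1 + ε) * Real.Gamma (1 + ε) := by
    rw [← Real.Gamma_add_one (by linarith)]; congr 1; ring
  have hG3 := one_add_div_three_le_Gamma h0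
  change W ε ≤ _
  rw [← ENNReal.ofReal_toReal hWtop]
  refine ENNReal.ofReal_le_ofReal ?_
  rw [le_div_iff₀ h0]
  have hw : 0 ≤ (W ε).toReal := ENNReal.toReal_nonneg
  have hd : 0 ≤ D.toReal := ENNReal.toReal_nonneg
  have k1 : (1 + ε) * (Real.Gamma (1 + ε) * (W ε).toReal)
      ≤ (1 + ε) * (1 / (1 + ε) * (W ε).toReal + D.toReal) :=
    mul_le_mul_of_nonneg_left keyr (by linarith)
  have k2 : (1 + ε) * (1 / (1 + ε) * (W ε).toReal + D.toReal)
      = (W ε).toReal + (1 + ε) * D.toReal := by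
    field_simp
  rw [k2, ← mul_assoc, ← hG2] at k1
  nlinarith

theorem two_sub_two_mul_cos_le_sq (x : ℝ) : 2 - 2 * Real.cos x ≤ x ^ 2 := by
  have := Real.one_sub_sq_div_two_le_cos (x := x)
  linarith

theorem two_sub_two_mul_cos_le_four (x : ℝ) : 2 - 2 * Real.cos x ≤ 4 := by
  have := Real.neg_one_le_cos x
  linarith

theorem sq_div_three_le_two_sub_two_mul_cos {x : ℝ} (hx : |x| ≤ 1) :
    x ^ 2 / 3 ≤ 2 - 2 * Real.cos x := by
  have h := Real.cos_le_one_sub_mul_cos_sq (x := x) (by linarith [Real.pi_gt_three])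
  have hpi : Real.pi ^ 2 ≤ 12 := by nlinarith [Real.pi_lt_d2, Real.pi_pos]
  have h2 : 1 / 6 ≤ 2 / Real.pi ^ 2 := by
    rw [div_le_div_iff₀ (by norm_num) (by positivity)]
    linarith
  nlinarith [mul_le_mul_of_nonneg_right h2 (sq_nonneg x)]

theorem lintegral_oscillation_le {t ε : ℝ} (ht : 0 < t) (h0 : 0 < ε) (h1 : ε ≤ 1 / 2) :
    ∫⁻ δ in Ioi (0 : ℝ), ENNReal.ofReal (δ ^ (-2 + ε) * (2 - 2 * Real.cos (δ * t)))
      ≤ ENNReal.ofReal (9 * t ^ (1 - ε)) := by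
  have hti : 0 < t⁻¹ := inv_pos.2 ht
  rw [← Ioc_union_Ioi_eq_Ioi hti.le]
  refine (lintegral_union_le _ _ _).trans ?_
  have a1 : ∫⁻ δ in Ioc (0 : ℝ) t⁻¹, ENNReal.ofReal (δ ^ (-2 + ε) * (2 - 2 * Real.cos (δ * t)))
      ≤ ENNReal.ofReal (t ^ (1 - ε)) := by
    calc _ ≤ ∫⁻ δ in Ioc (0 : ℝ) t⁻¹, ENNReal.ofReal (t ^ 2) * ENNReal.ofReal (δ ^ (-1 + (1 + ε))) := by
          refine setLIntegral_mono' measurableSet_Ioc fun δ hδ => ?_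
          rw [← ENNReal.ofReal_mul (by positivity)]
          refine ENNReal.ofReal_le_ofReal ?_
          calc _ ≤ δ ^ (-2 + ε) * (δ * t) ^ 2 :=
                mul_le_mul_of_nonneg_left (two_sub_two_mul_cos_le_sq _) (Real.rpow_nonneg hδ.1.le _)
            _ = t ^ 2 * (δ ^ (-2 + ε) * δ ^ (2 : ℕ)) := by ring
            _ = _ := by
              rw [← Real.rpow_natCast, ← Real.rpow_natCast δ, ← Real.rpow_add hδ.1]
              congr 2; push_cast; ring
      _ = ENNReal.ofReal (t ^ 2 * (t⁻¹ ^ (1 + ε) / (1 + ε))) := by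
          rw [lintegral_const_mul _ (by fun_prop), lintegral_Ioc_rpow hti (by linarith),
            ← ENNReal.ofReal_mul (by positivity)]
      _ ≤ _ := by
          refine ENNReal.ofReal_le_ofReal ?_
          have e : t ^ 2 * t⁻¹ ^ (1 + ε) = t ^ (1 - ε) := by
            rw [Real.inv_rpow ht.le, ← Real.rpow_neg ht.le, ← Real.rpow_natCast, ← Real.rpow_add ht]
            congr 1; push_cast; ring
          rw [← mul_div_assoc, e]
          exact div_le_self (Real.rpow_nonneg ht.le _) (by linarith)
  have a2 : ∫⁻ δ in Ioi t⁻¹, ENNReal.ofReal (δ ^ (-2 + ε) * (2 - 2 * Real.cos (δ * t)))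
      ≤ ENNReal.ofReal (8 * t ^ (1 - ε)) := by
    calc _ ≤ ∫⁻ δ in Ioi t⁻¹, ENNReal.ofReal (4 * δ ^ (-2 + ε)) := by
          refine setLIntegral_mono' measurableSet_Ioi fun δ hδ => ?_
          refine ENNReal.ofReal_le_ofReal ?_
          rw [mul_comm 4]
          exact mul_le_mul_of_nonneg_left (two_sub_two_mul_cos_le_four _)
            (Real.rpow_nonneg (hti.trans hδ).le _)
      _ = ENNReal.ofReal (∫ δ in Ioi t⁻¹, 4 * δ ^ (-2 + ε)) := by
          rw [ofReal_integral_eq_lintegral_ofReal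
            ((integrableOn_Ioi_rpow_of_lt (by linarith) hti).const_mul 4)]
          filter_upwards [ae_restrict_mem measurableSet_Ioi] with x hx
          exact mul_nonneg (by norm_num) (Real.rpow_nonneg (hti.trans hx).le _)
      _ ≤ _ := by
          refine ENNReal.ofReal_le_ofReal ?_
          rw [integral_const_mul, integral_Ioi_rpow_of_lt (by linarith) hti,
            show -2 + ε + 1 = -(1 - ε) by ring, neg_div_neg_eq, Real.inv_rpow ht.le,
            Real.rpow_neg ht.le, inv_inv, ← mul_div_assoc, div_le_iff₀ (by linarith)]
          have := Real.rpow_nonneg ht.le (1 - ε)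
          nlinarith
  refine (add_le_add a1 a2).trans ?_
  have := Real.rpow_nonneg ht.le (1 - ε)
  rw [← ENNReal.ofReal_add this (by positivity)]
  exact ENNReal.ofReal_le_ofReal (by linarith)

theorem le_lintegral_oscillation {t ε : ℝ} (ht : 1 ≤ t) (h0 : 0 < ε) (h1 : ε ≤ 1 / 2) :
    ENNReal.ofReal (t ^ (1 - ε) / 6)
      ≤ ∫⁻ δ in Ioc (0 : ℝ) 1, ENNReal.ofReal (δ ^ (-2 + ε) * (2 - 2 * Real.cos (δ * t))) := by
  have ht0 : 0 < t := by linarith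
  have hti : 0 < t⁻¹ := inv_pos.2 ht0
  calc _ ≤ ENNReal.ofReal (t ^ 2 / 3 * (t⁻¹ ^ (1 + ε) / (1 + ε))) := by
        refine ENNReal.ofReal_le_ofReal ?_
        have e : t ^ 2 * t⁻¹ ^ (1 + ε) = t ^ (1 - ε) := by
          rw [Real.inv_rpow ht0.le, ← Real.rpow_neg ht0.le, ← Real.rpow_natCast, ← Real.rpow_add ht0]
          congr 1; push_cast; ring
        rw [show t ^ 2 / 3 * (t⁻¹ ^ (1 + ε) / (1 + ε)) = t ^ 2 * t⁻¹ ^ (1 + ε) / (3 * (1 + ε)) by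
          field_simp, e]
        exact div_le_div_of_nonneg_left (Real.rpow_nonneg ht0.le _) (by linarith) (by linarith)
    _ = ∫⁻ δ in Ioc (0 : ℝ) t⁻¹, ENNReal.ofReal (t ^ 2 / 3) * ENNReal.ofReal (δ ^ (-1 + (1 + ε))) := by
        rw [lintegral_const_mul _ (by fun_prop), lintegral_Ioc_rpow hti (by linarith),
          ← ENNReal.ofReal_mul (by positivity)]
    _ ≤ ∫⁻ δ in Ioc (0 : ℝ) t⁻¹, ENNReal.ofReal (δ ^ (-2 + ε) * (2 - 2 * Real.cos (δ * t))) := by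
        refine setLIntegral_mono' measurableSet_Ioc fun δ hδ => ?_
        rw [← ENNReal.ofReal_mul (by positivity)]
        refine ENNReal.ofReal_le_ofReal ?_
        calc _ = t ^ 2 / 3 * (δ ^ (-2 + ε) * δ ^ (2 : ℕ)) := by
              rw [← Real.rpow_natCast, ← Real.rpow_natCast δ, ← Real.rpow_add hδ.1]
              congr 2; push_cast; ring
          _ = δ ^ (-2 + ε) * ((δ * t) ^ 2 / 3) := by ring
          _ ≤ _ := by
              refine mul_le_mul_of_nonneg_left (sq_div_three_le_two_sub_two_mul_cos ?_)
                (Real.rpow_nonneg hδ.1.le _)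
              rw [abs_of_nonneg (mul_nonneg hδ.1.le ht0.le)]
              calc δ * t ≤ t⁻¹ * t := mul_le_mul_of_nonneg_right hδ.2 ht0.le
                _ = 1 := inv_mul_cancel₀ ht0.ne'
    _ ≤ _ := lintegral_mono_set (Ioc_subset_Ioc_right (inv_le_one_of_one_le₀ ht))

theorem lintegral_oscillation_swap (ν : Measure ℝ) [SFinite ν] (ε η : ℝ) :
    ∫⁻ δ in Ioc 0 η, ENNReal.ofReal (δ ^ (-2 + ε))
        * ∫⁻ t, ENNReal.ofReal ((2 - 2 * Real.cos (δ * t)) / (1 / 4 + t ^ 2)) ∂ν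
      = ∫⁻ t, ENNReal.ofReal (1 / (1 / 4 + t ^ 2))
        * (∫⁻ δ in Ioc 0 η, ENNReal.ofReal (δ ^ (-2 + ε) * (2 - 2 * Real.cos (δ * t)))) ∂ν := by
  have e1 : ∀ δ : ℝ, ENNReal.ofReal (δ ^ (-2 + ε))
        * ∫⁻ t, ENNReal.ofReal ((2 - 2 * Real.cos (δ * t)) / (1 / 4 + t ^ 2)) ∂ν
      = ∫⁻ t, ENNReal.ofReal (δ ^ (-2 + ε))
        * ENNReal.ofReal ((2 - 2 * Real.cos (δ * t)) / (1 / 4 + t ^ 2)) ∂ν := fun δ =>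
    (lintegral_const_mul _ (by fun_prop)).symm
  simp only [e1]
  rw [lintegral_lintegral_swap (Measurable.aemeasurable (by fun_prop))]
  refine lintegral_congr fun t => ?_
  rw [← lintegral_const_mul _ (by fun_prop)]
  refine setLIntegral_congr_fun measurableSet_Ioc fun δ hδ => ?_
  have h1 : 0 ≤ δ ^ (-2 + ε) := Real.rpow_nonneg hδ.1.le _
  rw [← ENNReal.ofReal_mul h1, ← ENNReal.ofReal_mul (by positivity)]
  congr 1
  ring

theorem lintegral_Ioi_rpow_lt_top (ν : Measure ℝ) [SFinite ν] {a b d : ℝ} (ha : 1 ≤ a)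
    (hb : 0 ≤ b) (hd : 0 ≤ d)
    (hup : ∀ δ : ℝ, 0 < δ → δ ≤ 1 →
      ∫⁻ t, ENNReal.ofReal ((2 - 2 * Real.cos (δ * t)) / (1 / 4 + t ^ 2)) ∂ν
        ≤ ENNReal.ofReal (δ * (b * Real.log δ⁻¹ + d)))
    {ε : ℝ} (h0 : 0 < ε) (h1 : ε ≤ 1 / 2) :
    ∫⁻ t in Ioi a, ENNReal.ofReal (t ^ (-1 - ε)) ∂ν < ⊤ := by
  calc ∫⁻ t in Ioi a, ENNReal.ofReal (t ^ (-1 - ε)) ∂ν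
      ≤ ∫⁻ t in Ioi a, 12 * (ENNReal.ofReal (1 / (1 / 4 + t ^ 2))
        * (∫⁻ δ in Ioc 0 1, ENNReal.ofReal (δ ^ (-2 + ε) * (2 - 2 * Real.cos (δ * t))))) ∂ν := by
        refine setLIntegral_mono' measurableSet_Ioi fun t ht => ?_
        have ht1 : 1 ≤ t := ha.trans (le_of_lt ht)
        have ht0 : 0 < t := by linarith
        calc _ ≤ ENNReal.ofReal 12 * (ENNReal.ofReal (1 / (1 / 4 + t ^ 2))
                * ENNReal.ofReal (t ^ (1 - ε) / 6)) := by
              rw [← ENNReal.ofReal_mul (by positivity), ← ENNReal.ofReal_mul (by norm_num)]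
              refine ENNReal.ofReal_le_ofReal ?_
              have e : t ^ (1 - ε) = t ^ (-1 - ε) * t ^ 2 := by
                rw [← Real.rpow_natCast t 2, ← Real.rpow_add ht0]; congr 1; push_cast; ring
              have hp := Real.rpow_pos_of_pos ht0 (-1 - ε)
              rw [e, show 12 * (1 / (1 / 4 + t ^ 2) * (t ^ (-1 - ε) * t ^ 2 / 6))
                = t ^ (-1 - ε) * (2 * t ^ 2) / (1 / 4 + t ^ 2) by field_simp; ring,
                le_div_iff₀ (by positivity)]
              refine mul_le_mul_of_nonneg_left ?_ hp.le
              nlinarith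
          _ ≤ _ := by
              rw [show ENNReal.ofReal 12 = 12 by simp]
              gcongr
              exact le_lintegral_oscillation ht1 h0 h1
    _ ≤ ∫⁻ t, 12 * (ENNReal.ofReal (1 / (1 / 4 + t ^ 2))
        * (∫⁻ δ in Ioc 0 1, ENNReal.ofReal (δ ^ (-2 + ε) * (2 - 2 * Real.cos (δ * t))))) ∂ν :=
        setLIntegral_le_lintegral _ _
    _ = 12 * ∫⁻ δ in Ioc 0 1, ENNReal.ofReal (δ ^ (-2 + ε))
        * ∫⁻ t, ENNReal.ofReal ((2 - 2 * Real.cos (δ * t)) / (1 / 4 + t ^ 2)) ∂ν := by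
        rw [lintegral_const_mul' _ _ (by simp), lintegral_oscillation_swap]
    _ ≤ 12 * ∫⁻ δ in Ioc 0 1, ENNReal.ofReal (2 * b / ε + d)
          * ENNReal.ofReal (δ ^ (-1 + ε / 2)) := by
        gcongr 12 * ?_
        refine setLIntegral_mono' measurableSet_Ioc fun δ hδ => ?_
        have hn : 0 ≤ δ ^ (-2 + ε) := Real.rpow_nonneg hδ.1.le _
        calc _ ≤ ENNReal.ofReal (δ ^ (-2 + ε)) * ENNReal.ofReal (δ * (b * Real.log δ⁻¹ + d)) := by
              gcongr
              exact hup δ hδ.1 hδ.2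
          _ ≤ _ := by
              rw [← ENNReal.ofReal_mul hn, ← ENNReal.ofReal_mul (by positivity)]
              refine ENNReal.ofReal_le_ofReal ?_
              have hl := Real.log_le_rpow_div (x := δ⁻¹) (inv_pos.2 hδ.1).le
                (show 0 < ε / 2 by linarith)
              rw [Real.inv_rpow hδ.1.le, ← Real.rpow_neg hδ.1.le] at hl
              have e1 : δ ^ (-2 + ε) * δ = δ ^ (-1 + ε) := by
                nth_rewrite 2 [← Real.rpow_one δ]
                rw [← Real.rpow_add hδ.1]; congr 1; ring
              have e2 : δ ^ (-1 + ε) * δ ^ (-(ε / 2)) = δ ^ (-1 + ε / 2) := by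
                rw [← Real.rpow_add hδ.1]; congr 1; ring
              have e3 : δ ^ (-1 + ε) ≤ δ ^ (-1 + ε / 2) :=
                Real.rpow_le_rpow_of_exponent_ge hδ.1 hδ.2 (by linarith)
              have e4 : 0 ≤ δ ^ (-1 + ε) := Real.rpow_nonneg hδ.1.le _
              calc δ ^ (-2 + ε) * (δ * (b * Real.log δ⁻¹ + d))
                  = δ ^ (-1 + ε) * (b * Real.log δ⁻¹) + d * δ ^ (-1 + ε) := by
                    rw [← e1]; ring
                _ ≤ δ ^ (-1 + ε) * (b * (δ ^ (-(ε / 2)) / (ε / 2))) + d * δ ^ (-1 + ε / 2) := by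
                    gcongr
                _ = (2 * b / ε) * (δ ^ (-1 + ε) * δ ^ (-(ε / 2))) + d * δ ^ (-1 + ε / 2) := by
                    field_simp
                _ = _ := by rw [e2]; ring
    _ < ⊤ := by
        rw [lintegral_const_mul _ (by fun_prop), lintegral_Ioc_rpow one_pos (by linarith)]
        exact ENNReal.mul_lt_top (by simp) (ENNReal.mul_lt_top ENNReal.ofReal_lt_top
          ENNReal.ofReal_lt_top)

theorem le_mellin_of_oscillation (ν : Measure ℝ) [SFinite ν] (hzero : ν (Iic 0) = 0)
    {a c d M : ℝ} (ha : 1 ≤ a) (hc : 0 < c)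
    (hlow : ∀ δ : ℝ, 0 < δ → δ ≤ 1 → ENNReal.ofReal (δ * (c * Real.log δ⁻¹ - d))
      ≤ ∫⁻ t, ENNReal.ofReal ((2 - 2 * Real.cos (δ * t)) / (1 / 4 + t ^ 2)) ∂ν)
    (hM : 2 ≤ M) (hMd : |d| ≤ M) :
    ENNReal.ofReal (M ^ 2 * Real.exp (-(2 / c)))
      ≤ ENNReal.ofReal (36 * a) * ν (Iic a)
        + ENNReal.ofReal 9 * ∫⁻ t in Ioi a, ENNReal.ofReal (t ^ (-1 - 1 / M)) ∂ν := by
  have hM0 : 0 < M := by linarith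
  set ε := 1 / M with hεdef
  have h0 : 0 < ε := by positivity
  have h1 : ε ≤ 1 / 2 := one_div_le_one_div_of_le (by norm_num) hM
  have hd := abs_le.1 hMd
  set η := Real.exp (-((M + d) / c)) with hη
  have hη0 : 0 < η := Real.exp_pos _
  have hη1 : η ≤ 1 := Real.exp_le_one_iff.2 (by
    have : 0 ≤ (M + d) / c := div_nonneg (by linarith) hc.le
    linarith)
  calc ENNReal.ofReal (M ^ 2 * Real.exp (-(2 / c)))
      ≤ ENNReal.ofReal (M * (η ^ ε / ε)) := by
        refine ENNReal.ofReal_le_ofReal ?_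
        have e1 : η ^ ε = Real.exp (-((M + d) / c) * ε) := by rw [hη, ← Real.exp_mul]
        have e2 : Real.exp (-(2 / c)) ≤ η ^ ε := by
          rw [e1]
          refine Real.exp_le_exp.2 ?_
          have : (M + d) / c * ε ≤ 2 / c := by
            rw [hεdef, div_mul_div_comm, mul_one, div_le_div_iff₀ (by positivity) hc]
            nlinarith
          linarith
        rw [hεdef, div_div_eq_mul_div, div_one, ← hεdef]
        nlinarith [mul_le_mul_of_nonneg_left e2 (sq_nonneg M)]
    _ = ∫⁻ δ in Ioc 0 η, ENNReal.ofReal M * ENNReal.ofReal (δ ^ (-1 + ε)) := by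
        rw [lintegral_const_mul _ (by fun_prop), lintegral_Ioc_rpow hη0 h0, ENNReal.ofReal_mul hM0.le]
    _ ≤ ∫⁻ δ in Ioc 0 η, ENNReal.ofReal (δ ^ (-2 + ε))
        * ∫⁻ t, ENNReal.ofReal ((2 - 2 * Real.cos (δ * t)) / (1 / 4 + t ^ 2)) ∂ν := by
        refine setLIntegral_mono' measurableSet_Ioc fun δ hδ => ?_
        have hn : 0 ≤ δ ^ (-2 + ε) := Real.rpow_nonneg hδ.1.le _
        calc _ ≤ ENNReal.ofReal (δ ^ (-2 + ε)) * ENNReal.ofReal (δ * (c * Real.log δ⁻¹ - d)) := by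
              rw [← ENNReal.ofReal_mul hn, ← ENNReal.ofReal_mul hM0.le]
              refine ENNReal.ofReal_le_ofReal ?_
              have e1 : δ ^ (-2 + ε) * δ = δ ^ (-1 + ε) := by
                nth_rewrite 2 [← Real.rpow_one δ]
                rw [← Real.rpow_add hδ.1]; congr 1; ring
              have hl : (M + d) / c ≤ Real.log δ⁻¹ := by
                rw [Real.log_inv, le_neg]
                calc Real.log δ ≤ Real.log η := Real.log_le_log hδ.1 hδ.2
                  _ = _ := by rw [hη, Real.log_exp]
              rw [div_le_iff₀ hc] at hl
              rw [← mul_assoc, e1, mul_comm]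
              exact mul_le_mul_of_nonneg_left (by linarith) (Real.rpow_nonneg hδ.1.le _)
          _ ≤ _ := by
              gcongr
              exact hlow δ hδ.1 (hδ.2.trans hη1)
    _ = ∫⁻ t, ENNReal.ofReal (1 / (1 / 4 + t ^ 2))
        * (∫⁻ δ in Ioc 0 η, ENNReal.ofReal (δ ^ (-2 + ε) * (2 - 2 * Real.cos (δ * t)))) ∂ν :=
        lintegral_oscillation_swap ν ε η
    _ ≤ ∫⁻ t, ENNReal.ofReal (1 / (1 / 4 + t ^ 2) * (9 * t ^ (1 - ε))) ∂ν := by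
        refine lintegral_mono_ae ?_
        have hpos : ∀ᵐ t ∂ν, 0 < t := by
          rw [ae_iff]
          simp only [not_lt]
          exact hzero
        filter_upwards [hpos] with t ht
        rw [ENNReal.ofReal_mul (by positivity)]
        gcongr
        exact (lintegral_mono_set Ioc_subset_Ioi_self).trans (lintegral_oscillation_le ht h0 h1)
    _ = (∫⁻ t in Iic a, ENNReal.ofReal (1 / (1 / 4 + t ^ 2) * (9 * t ^ (1 - ε))) ∂ν)
        + ∫⁻ t in Ioi a, ENNReal.ofReal (1 / (1 / 4 + t ^ 2) * (9 * t ^ (1 - ε))) ∂ν := by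
        rw [← compl_Iic, lintegral_add_compl _ measurableSet_Iic]
    _ ≤ _ := by
        refine add_le_add ?_ ?_
        · calc _ ≤ ∫⁻ t in Iic a, ENNReal.ofReal (36 * a) ∂ν := by
                refine lintegral_mono_ae ?_
                have hpos : ∀ᵐ t ∂ν.restrict (Iic a), 0 < t := by
                  refine ae_restrict_of_ae ?_
                  rw [ae_iff]
                  simp only [not_lt]
                  exact hzero
                filter_upwards [hpos, ae_restrict_mem measurableSet_Iic] with t ht hta
                refine ENNReal.ofReal_le_ofReal ?_
                have e1 : t ^ (1 - ε) ≤ a := by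
                  calc t ^ (1 - ε) ≤ a ^ (1 - ε) := Real.rpow_le_rpow ht.le hta (by linarith)
                    _ ≤ a ^ (1 : ℝ) := Real.rpow_le_rpow_of_exponent_le ha (by linarith)
                    _ = a := Real.rpow_one a
                have e2 : 1 / (1 / 4 + t ^ 2) ≤ 4 := by
                  rw [div_le_iff₀ (by positivity)]; nlinarith
                calc _ ≤ 4 * (9 * a) := by
                      gcongr
                  _ = 36 * a := by ring
            _ = _ := by rw [setLIntegral_const]
        · rw [← lintegral_const_mul _ (by fun_prop)]
          refine setLIntegral_mono' measurableSet_Ioi fun t ht => ?_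
          have ht0 : 0 < t := by have : a < t := ht; linarith
          rw [← ENNReal.ofReal_mul (by norm_num)]
          refine ENNReal.ofReal_le_ofReal ?_
          have e : t ^ (1 - ε) = t ^ (-1 - ε) * t ^ 2 := by
            rw [← Real.rpow_natCast t 2, ← Real.rpow_add ht0]; congr 1; push_cast; ring
          have hp := Real.rpow_pos_of_pos ht0 (-1 - ε)
          rw [e, one_div_mul_eq_div, div_le_iff₀ (by positivity)]
          nlinarith

/-- A measure whose oscillation integrals are of size `δ log (1 / δ)` has, at arbitrarily large
places, a Laplace transform exceeding its distribution function by any given constant. -/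
theorem exists_measure_Iic_add_lt_laplace (ν : Measure ℝ) [SFinite ν] (hzero : ν (Iic 0) = 0)
    (hfin : ∀ x, ν (Iic x) < ⊤) {b d c e : ℝ} (hb : 0 ≤ b) (hd : 0 ≤ d) (hc : 0 < c)
    (hup : ∀ δ : ℝ, 0 < δ → δ ≤ 1 →
      ∫⁻ t, ENNReal.ofReal ((2 - 2 * Real.cos (δ * t)) / (1 / 4 + t ^ 2)) ∂ν
        ≤ ENNReal.ofReal (δ * (b * Real.log δ⁻¹ + d)))
    (hlow : ∀ δ : ℝ, 0 < δ → δ ≤ 1 → ENNReal.ofReal (δ * (c * Real.log δ⁻¹ - e))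
      ≤ ∫⁻ t, ENNReal.ofReal ((2 - 2 * Real.cos (δ * t)) / (1 / 4 + t ^ 2)) ∂ν)
    (a C : ℝ) :
    ∃ x, a < x ∧ ν (Iic x) + ENNReal.ofReal C < ∫⁻ t, ENNReal.ofReal (Real.exp (-(t / x))) ∂ν := by
  by_contra! hcon
  have hA : 1 ≤ max a 1 := le_max_right _ _
  set A := max a 1 with hAdef
  obtain ⟨B, hB0, hB⟩ := exists_mellin_bound ν hfin (C := C) hA
    (fun ε h0 h1 => lintegral_Ioi_rpow_lt_top ν hA hb hd hup h0 h1)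
    (fun x hx => hcon x ((le_max_left a 1).trans_lt hx))
  set N := (ν (Iic A)).toReal with hN
  have hN0 : 0 ≤ N := ENNReal.toReal_nonneg
  set Q := 36 * A * N + 9 * B with hQ
  have hQ0 : 0 ≤ Q := by positivity
  set M := Real.exp (2 / c) * (Q + 1) + 2 + |e| with hM
  have hE : 0 < Real.exp (2 / c) := Real.exp_pos _
  have hp : 0 ≤ Real.exp (2 / c) * (Q + 1) := by positivity
  have hM2 : 2 ≤ M := by have := abs_nonneg e; linarith
  have key := le_mellin_of_oscillation ν hzero hA hc hlow hM2 (by linarith : |e| ≤ M)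
  have hb2 := hB (1 / M) (by positivity) (one_div_le_one_div_of_le (by norm_num) hM2)
  have key2 : ENNReal.ofReal (M ^ 2 * Real.exp (-(2 / c)))
      ≤ ENNReal.ofReal (36 * A * N + 9 * (B * M)) := by
    calc _ ≤ _ := key
      _ ≤ ENNReal.ofReal (36 * A) * ENNReal.ofReal N
          + ENNReal.ofReal 9 * ENNReal.ofReal (B / (1 / M)) := by
          gcongr
          rw [hN, ENNReal.ofReal_toReal (hfin A).ne]
      _ = _ := by
          rw [← ENNReal.ofReal_mul (by positivity), ← ENNReal.ofReal_mul (by norm_num),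
            ← ENNReal.ofReal_add (by positivity) (by positivity)]
          congr 2
          field_simp
  rw [ENNReal.ofReal_le_ofReal_iff (by positivity)] at key2
  have k1 : Q + 1 ≤ M * Real.exp (-(2 / c)) := by
    rw [Real.exp_neg, ← div_eq_mul_inv, le_div_iff₀ hE]
    have := abs_nonneg e
    linarith
  have k2 : M * (Q + 1) ≤ M ^ 2 * Real.exp (-(2 / c)) := by
    rw [sq, mul_assoc]
    exact mul_le_mul_of_nonneg_left k1 (by linarith)
  have k3 : 36 * A * N ≤ 36 * A * N * M := le_mul_of_one_le_right (by positivity) (by linarith)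
  rw [hQ] at k2
  linarith

theorem hardyMeasure_oscillation_le {δ : ℝ} (h0 : 0 < δ) (h1 : δ ≤ 1) :
    ∫⁻ t, ENNReal.ofReal ((2 - 2 * Real.cos (δ * t)) / (1 / 4 + t ^ 2)) ∂hardyMeasure
      ≤ ENNReal.ofReal (δ * (7 * Real.pi * Real.log δ⁻¹ + 12 * Real.pi)) := by
  rw [lintegral_hardyMeasure_oscillation]
  calc _ ≤ ENNReal.ofReal Real.pi * ENNReal.ofReal (δ * (7 * Real.log δ⁻¹ + 12)) := by
        gcongr
        exact lintegral_fractDiff_sq_le h0 h1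
    _ = _ := by
        rw [← ENNReal.ofReal_mul Real.pi_pos.le]
        congr 1; ring

theorem le_hardyMeasure_oscillation {δ : ℝ} (h0 : 0 < δ) (h1 : δ ≤ 1) :
    ENNReal.ofReal (δ * (Real.pi / 8 * Real.log δ⁻¹ - 2 * Real.pi))
      ≤ ∫⁻ t, ENNReal.ofReal ((2 - 2 * Real.cos (δ * t)) / (1 / 4 + t ^ 2)) ∂hardyMeasure := by
  rw [lintegral_hardyMeasure_oscillation]
  calc _ = ENNReal.ofReal Real.pi * ENNReal.ofReal (δ * (Real.log δ⁻¹ / 8 - 2)) := by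
        rw [← ENNReal.ofReal_mul Real.pi_pos.le]
        congr 1; ring
    _ ≤ _ := by
        gcongr
        exact le_lintegral_fractDiff_sq h0 h1

theorem exp_neg_div_le_of_log_le {x t : ℝ} (hx : 1 ≤ x) (ht : 14 * x * Real.log (2 * x) ≤ t) :
    1 ≤ t ∧ Real.exp (-(t / x)) ≤ 384 * t ^ (-1 - 1 / 2 : ℝ) := by
  have hx0 : 0 < x := by linarith
  have hlog : 1 / 2 ≤ Real.log (2 * x) := by
    have : Real.log 2 ≤ Real.log (2 * x) := Real.log_le_log (by norm_num) (by linarith)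
    linarith [Real.log_two_gt_d9]
  have ht1 : 1 ≤ t := by nlinarith
  have ht0 : 0 < t := by linarith
  refine ⟨ht1, ?_⟩
  have e1 : Real.exp (-(t / x / 2)) ≤ (x ^ 4)⁻¹ := by
    have h1 : 4 * Real.log x ≤ t / x / 2 := by
      have : Real.log x ≤ Real.log (2 * x) := Real.log_le_log hx0 (by linarith)
      have h2 : 14 * Real.log (2 * x) ≤ t / x := by
        rw [le_div_iff₀ hx0]; linarith
      linarith
    calc Real.exp (-(t / x / 2)) ≤ Real.exp (-(4 * Real.log x)) := Real.exp_le_exp.2 (by linarith)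
      _ = _ := by
        rw [Real.exp_neg, show (4 : ℝ) * Real.log x = Real.log (x ^ 4) by
          rw [Real.log_pow]; norm_num, Real.exp_log (by positivity)]
  have e2 := exp_neg_le_div_pow_four (v := t / x / 2) (by positivity)
  have e3 : (t ^ (4 : ℕ))⁻¹ ≤ t ^ (-1 - 1 / 2 : ℝ) := by
    rw [← Real.rpow_natCast, ← Real.rpow_neg ht0.le]
    refine Real.rpow_le_rpow_of_exponent_le ht1 ?_
    norm_num
  calc Real.exp (-(t / x)) = Real.exp (-(t / x / 2)) * Real.exp (-(t / x / 2)) := by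
        rw [← Real.exp_add]; congr 1; ring
    _ ≤ (x ^ 4)⁻¹ * (24 / (t / x / 2) ^ 4) :=
        mul_le_mul e1 e2 (Real.exp_pos _).le (by positivity)
    _ = 384 * (t ^ (4 : ℕ))⁻¹ := by
        field_simp; norm_num
    _ ≤ _ := by gcongr

theorem Phi_two_mul {μ : ℝ → ℝ} {x : ℝ} (hμ : 0 ≤ μ (2 * x)) :
    ENNReal.ofReal (Phi μ (2 * x))
      = ∫⁻ t in Iic (μ (2 * x)), ENNReal.ofReal (Real.exp (-(t / x))) ∂hardyMeasure := by
  have hc : Continuous fun t : ℝ => hardyZSq t * Real.exp (-(2 / (2 * x)) * t) :=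
    continuous_hardyZSq.mul (by fun_prop)
  rw [Phi, intervalIntegral.integral_of_le hμ, ofReal_integral_eq_lintegral_ofReal
    (hc.intervalIntegrable 0 _).1
    (Eventually.of_forall fun t => mul_nonneg (hardyZSq_nonneg t) (Real.exp_pos _).le),
    ← lintegral_indicator measurableSet_Iic, lintegral_hardyMeasure
      (Measurable.indicator (by fun_prop) measurableSet_Iic), ← Ioi_inter_Iic, inter_comm,
    ← Measure.restrict_restrict measurableSet_Iic, ← lintegral_indicator measurableSet_Iic]
  refine lintegral_congr fun t => ?_
  by_cases h : t ∈ Iic (μ (2 * x))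
  · rw [indicator_of_mem h, indicator_of_mem h, ENNReal.ofReal_mul (hardyZSq_nonneg t)]
    congr 3
    rw [mul_comm 2 x, div_mul_eq_div_div_swap, div_self two_ne_zero]
    ring
  · rw [indicator_of_notMem h, indicator_of_notMem h, mul_zero]

/-- At arbitrarily large places the smoothed second moment exceeds the Hardy-Littlewood integral. -/
theorem exists_hardyLittlewood_lt_Phi {μ : ℝ → ℝ} {y₀ : ℝ} (hμ : IsAdmissible μ y₀) (a : ℝ) :
    ∃ x, a < x ∧ hardyLittlewood x < Phi μ (2 * x) := by
  have hpi := Real.pi_pos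
  have hQ := lintegral_Ioi_rpow_lt_top hardyMeasure le_rfl (by positivity) (by positivity)
    (fun δ => hardyMeasure_oscillation_le) (ε := 1 / 2) (by norm_num) le_rfl
  set Q := ∫⁻ t in Ioi 1, ENNReal.ofReal (t ^ (-1 - 1 / 2 : ℝ)) ∂hardyMeasure with hQdef
  obtain ⟨x, hx, hlt⟩ := exists_measure_Iic_add_lt_laplace hardyMeasure hardyMeasure_Iic_zero
    hardyMeasure_Iic_lt_top (by positivity) (by positivity) (by positivity : 0 < Real.pi / 8)
    (fun δ => hardyMeasure_oscillation_le) (fun δ => le_hardyMeasure_oscillation)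
    (max a (max 1 y₀)) (384 * Q.toReal)
  have hxa : a < x := (le_max_left _ _).trans_lt hx
  have hx1 : 1 < x := ((le_max_left _ _).trans (le_max_right _ _)).trans_lt hx
  have hxy : y₀ < x := ((le_max_right _ _).trans (le_max_right _ _)).trans_lt hx
  refine ⟨x, hxa, ?_⟩
  have hx2 : y₀ ≤ 2 * x := by linarith
  have hb := hμ.bound (2 * x) hx2
  have htail : ∫⁻ t in Ioi (μ (2 * x)), ENNReal.ofReal (Real.exp (-(t / x))) ∂hardyMeasure
      ≤ ENNReal.ofReal (384 * Q.toReal) := by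
    have hm1 : 1 ≤ μ (2 * x) := (exp_neg_div_le_of_log_le hx1.le (by linarith)).1
    calc _ ≤ ∫⁻ t in Ioi (μ (2 * x)), ENNReal.ofReal 384
            * ENNReal.ofReal (t ^ (-1 - 1 / 2 : ℝ)) ∂hardyMeasure := by
          refine setLIntegral_mono' measurableSet_Ioi fun t ht => ?_
          have ht' : μ (2 * x) < t := ht
          rw [← ENNReal.ofReal_mul (by norm_num)]
          exact ENNReal.ofReal_le_ofReal (exp_neg_div_le_of_log_le hx1.le (by linarith)).2
      _ = ENNReal.ofReal 384 * ∫⁻ t in Ioi (μ (2 * x)),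
            ENNReal.ofReal (t ^ (-1 - 1 / 2 : ℝ)) ∂hardyMeasure :=
          lintegral_const_mul _ (by fun_prop)
      _ ≤ ENNReal.ofReal 384 * Q := by
          gcongr
          exact lintegral_mono_set (Ioi_subset_Ioi hm1)
      _ = _ := by rw [ENNReal.ofReal_mul (by norm_num), ENNReal.ofReal_toReal hQ.ne]
  rw [← lintegral_add_compl _ (measurableSet_Iic (a := μ (2 * x))), compl_Iic,
    ← Phi_two_mul (hμ.pos _ hx2).le, hardyMeasure_Iic (by linarith)] at hlt
  have h2 := hlt.trans_le (add_le_add le_rfl htail)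
  have h3 := lt_of_add_lt_add_right h2
  exact (ENNReal.ofReal_lt_ofReal_iff_of_nonneg
    (intervalIntegral.integral_nonneg (by linarith) fun t _ => hardyZSq_nonneg t)).1 h3

theorem exists_hardyZSq_pos {a b : ℝ} (hab : a < b) : ∃ c ∈ Ioo a b, 0 < hardyZSq c := by
  by_contra! hcon
  have hz : ∀ c ∈ Ioo a b, riemannZeta₁ (1 / 2 + Complex.I * (c : ℂ)) = 0 := by
    intro c hc
    have h0 : hardyZSq c = 0 := le_antisymm (hcon c hc) (hardyZSq_nonneg c)
    rw [hardyZSq_eq, sq_eq_zero_iff, norm_eq_zero,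
      riemannZeta_eq_inv_sub_mul (half_add_I_mul_ne_one c)] at h0
    exact (mul_eq_zero.1 h0).resolve_left
      (inv_ne_zero (sub_ne_zero.2 (half_add_I_mul_ne_one c)))
  obtain ⟨c₀, hc₀⟩ := nonempty_Ioo.2 hab
  have hfreq : ∃ᶠ z in 𝓝[≠] (1 / 2 + Complex.I * (c₀ : ℂ)), riemannZeta₁ z = 0 := by
    have ht : Tendsto (fun c : ℝ => 1 / 2 + Complex.I * (c : ℂ)) (𝓝[≠] c₀)
        (𝓝[≠] (1 / 2 + Complex.I * (c₀ : ℂ))) := by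
      refine tendsto_nhdsWithin_of_tendsto_nhds_of_eventually_within _
        ((Continuous.tendsto (by fun_prop) c₀).mono_left nhdsWithin_le_nhds) ?_
      filter_upwards [self_mem_nhdsWithin] with c hc h
      apply hc
      simpa using h
    refine ht.frequently (Eventually.frequently ?_)
    filter_upwards [nhdsWithin_le_nhds (isOpen_Ioo.mem_nhds hc₀)] with c hc using hz c hc
  have han : AnalyticOnNhd ℂ riemannZeta₁ univ :=
    fun z _ => differentiable_riemannZeta₁.analyticAt z
  have := han.eqOn_zero_of_preconnected_of_frequently_eq_zero isPreconnected_univ (mem_univ _) hfreq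
  have h1 := this (mem_univ (1 : ℂ))
  simp at h1

theorem integral_hardyZSq_mul_pos {w : ℝ → ℝ} (hw : Continuous w) {a b : ℝ} (hab : a < b)
    (hpos : ∀ t, a < t → 0 < w t) : 0 < ∫ t in a..b, hardyZSq t * w t := by
  obtain ⟨c, hc, hc0⟩ := exists_hardyZSq_pos hab
  exact intervalIntegral.integral_pos hab (continuous_hardyZSq.mul hw).continuousOn
    (fun t ht => mul_nonneg (hardyZSq_nonneg t) (hpos t ht.1).le)
    ⟨c, Ioo_subset_Icc_self hc, mul_pos hc0 (hpos c hc.1)⟩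

theorem hasDerivAt_hardyLittlewood (T : ℝ) : HasDerivAt hardyLittlewood (hardyZSq T) T :=
  intervalIntegral.integral_hasDerivAt_right (continuous_hardyZSq.intervalIntegrable 0 T)
    (continuous_hardyZSq.stronglyMeasurableAtFilter _ _) continuous_hardyZSq.continuousAt

theorem continuous_hardyLittlewood : Continuous hardyLittlewood :=
  continuous_iff_continuousAt.2 fun T => (hasDerivAt_hardyLittlewood T).continuousAt

theorem strictMono_hardyLittlewood : StrictMono hardyLittlewood := by
  intro a b hab
  have h := integral_hardyZSq_mul_pos continuous_const hab (fun _ _ => one_pos)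
  simp only [mul_one] at h
  have := intervalIntegral.integral_add_adjacent_intervals
    (continuous_hardyZSq.intervalIntegrable (μ := volume) 0 a)
    (continuous_hardyZSq.intervalIntegrable (μ := volume) a b)
  unfold hardyLittlewood
  linarith

theorem hasDerivAt_exp_neg_two_div_mul {y : ℝ} (hy : y ≠ 0) (t : ℝ) :
    HasDerivAt (fun y : ℝ => Real.exp (-(2 / y) * t))
      (Real.exp (-(2 / y) * t) * (2 * t / y ^ 2)) y := by
  have h1 : HasDerivAt (fun y : ℝ => -(2 / y) * t) (2 * t / y ^ 2) y := by
    have := (((hasDerivAt_inv hy).const_mul 2).neg).mul_const t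
    refine this.congr_deriv ?_ |>.congr_of_eventuallyEq ?_
    · field_simp
    · exact Eventually.of_forall fun z => by simp [div_eq_mul_inv]
  exact h1.exp

theorem hasDerivAt_integral_hardyZSq_mul_exp {y m : ℝ} (hy : 0 < y) :
    HasDerivAt (fun y => ∫ t in (0 : ℝ)..m, hardyZSq t * Real.exp (-(2 / y) * t))
      (∫ t in (0 : ℝ)..m, hardyZSq t * (Real.exp (-(2 / y) * t) * (2 * t / y ^ 2))) y := by
  have hs : Ioo (y / 2) (2 * y) ∈ 𝓝 y := isOpen_Ioo.mem_nhds ⟨by linarith, by linarith⟩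
  have hc : ∀ z : ℝ, Continuous fun t => hardyZSq t * Real.exp (-(2 / z) * t) := fun z =>
    continuous_hardyZSq.mul (by fun_prop)
  have hc' : ∀ z : ℝ, Continuous fun t => hardyZSq t * (Real.exp (-(2 / z) * t) * (2 * t / z ^ 2)) :=
    fun z => continuous_hardyZSq.mul (by fun_prop)
  have hb : Continuous fun t => hardyZSq t *
      (Real.exp (2 / (y / 2) * |t|) * (2 * |t| / (y / 2) ^ 2)) :=
    continuous_hardyZSq.mul (by fun_prop)
  refine (intervalIntegral.hasDerivAt_integral_of_dominated_loc_of_deriv_le (μ := volume)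
    (F := fun y t => hardyZSq t * Real.exp (-(2 / y) * t))
    (F' := fun y t => hardyZSq t * (Real.exp (-(2 / y) * t) * (2 * t / y ^ 2)))
    (bound := fun t => hardyZSq t * (Real.exp (2 / (y / 2) * |t|) * (2 * |t| / (y / 2) ^ 2)))
    hs ?_ ?_ ?_ ?_ ?_ ?_).2
  · exact Eventually.of_forall fun z => (hc z).aestronglyMeasurable
  · exact (hc y).intervalIntegrable _ _
  · exact (hc' y).aestronglyMeasurable
  · refine Eventually.of_forall fun t _ z hz => ?_
    have hz0 : 0 < z := by linarith [hz.1]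
    have hy2 : 0 < y / 2 := by linarith
    rw [norm_mul, norm_mul, Real.norm_of_nonneg (hardyZSq_nonneg t),
      Real.norm_of_nonneg (Real.exp_pos _).le, norm_div, norm_mul, Real.norm_two,
      Real.norm_of_nonneg (sq_nonneg z), Real.norm_eq_abs]
    have h1 : 2 / z ≤ 2 / (y / 2) := div_le_div_of_nonneg_left (by norm_num) hy2 hz.1.le
    have h2 : -(2 / z) * t ≤ 2 / (y / 2) * |t| := by
      calc -(2 / z) * t ≤ 2 / z * |t| := by
            have : -t ≤ |t| := neg_le_abs t
            have h3 : 0 < 2 / z := by positivity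
            nlinarith
        _ ≤ _ := mul_le_mul_of_nonneg_right h1 (abs_nonneg t)
    have h4 : y / 2 ≤ z := hz.1.le
    have h5 := hardyZSq_nonneg t
    gcongr
  · exact hb.intervalIntegrable _ _
  · refine Eventually.of_forall fun t _ z hz => ?_
    have hz0 : 0 < z := by linarith [hz.1]
    exact (hasDerivAt_exp_neg_two_div_mul hz0.ne' t).const_mul _

theorem abs_exp_neg_sub_exp_neg_le {a b : ℝ} (ha : 0 ≤ a) (hb : 0 ≤ b) :
    |Real.exp (-a) - Real.exp (-b)| ≤ |a - b| := by
  wlog hab : a ≤ b generalizing a b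
  · rw [abs_sub_comm, abs_sub_comm a b]
    exact this hb ha (le_of_not_ge hab)
  have h1 : Real.exp (-b) ≤ Real.exp (-a) := Real.exp_le_exp.2 (by linarith)
  rw [abs_of_nonneg (by linarith), abs_of_nonpos (by linarith)]
  have h2 : Real.exp (-a) ≤ 1 := Real.exp_le_one_iff.2 (by linarith)
  have h3 : Real.exp (-b) = Real.exp (-a) * Real.exp (-(b - a)) := by
    rw [← Real.exp_add]; congr 1; ring
  have h4 := Real.add_one_le_exp (-(b - a))
  rw [h3]
  nlinarith [Real.exp_pos (-a), Real.exp_pos (-(b - a))]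

theorem Phi_hasDerivWithinAt {μ : ℝ → ℝ} {y₀ : ℝ} (hμ : IsAdmissible μ y₀) {y μ' : ℝ} (hy : y₀ ≤ y)
    (hd : HasDerivWithinAt μ μ' (Ici y₀) y) :
    HasDerivWithinAt (Phi μ)
      ((∫ t in (0 : ℝ)..(μ y), hardyZSq t * (Real.exp (-(2 / y) * t) * (2 * t / y ^ 2)))
        + hardyZSq (μ y) * Real.exp (-(2 / y) * μ y) * μ') (Ici y₀) y := by
  have hy₀ := hμ.pos_start
  have hy0 : 0 < y := hy₀.trans_le hy
  have hm := hμ.pos y hy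
  have hc : ∀ z : ℝ, Continuous fun t => hardyZSq t * Real.exp (-(2 / z) * t) := fun z =>
    continuous_hardyZSq.mul (by fun_prop)
  have hG := (hasDerivAt_integral_hardyZSq_mul_exp (m := μ y) hy0).hasDerivWithinAt (s := Ici y₀)
  have hP : HasDerivAt (fun b => ∫ t in (μ y)..b, hardyZSq t * Real.exp (-(2 / y) * t))
      (hardyZSq (μ y) * Real.exp (-(2 / y) * μ y)) (μ y) :=
    intervalIntegral.integral_hasDerivAt_right ((hc y).intervalIntegrable _ _)
      ((hc y).stronglyMeasurableAtFilter _ _) (hc y).continuousAt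
  have hH := hP.comp_hasDerivWithinAt y hd
  have hR : HasDerivWithinAt (fun z => ∫ t in (μ y)..(μ z),
      hardyZSq t * (Real.exp (-(2 / z) * t) - Real.exp (-(2 / y) * t))) 0 (Ici y₀) y := by
    rw [hasDerivWithinAt_iff_isLittleO]
    simp only [intervalIntegral.integral_same, sub_zero, smul_zero]
    obtain ⟨B, hB⟩ := (isCompact_Icc (a := (0 : ℝ)) (b := μ y + 1)).exists_bound_of_continuousOn
      continuous_hardyZSq.continuousOn
    have hB0 : 0 ≤ B := (norm_nonneg _).trans (hB 0 ⟨le_rfl, by linarith⟩)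
    have hcont : Tendsto μ (𝓝[Ici y₀] y) (𝓝 (μ y)) := hd.continuousWithinAt
    have hbig : (fun z => ∫ t in (μ y)..(μ z),
        hardyZSq t * (Real.exp (-(2 / z) * t) - Real.exp (-(2 / y) * t)))
        =O[𝓝[Ici y₀] y] fun z => (μ z - μ y) * (z - y) := by
      refine Asymptotics.IsBigO.of_bound (B * (2 / y₀ ^ 2 * (μ y + 1))) ?_
      filter_upwards [self_mem_nhdsWithin, hcont.eventually (gt_mem_nhds (lt_add_one (μ y)))]
        with z hz hz1
      have hz : y₀ ≤ z := hz
      have hz0 : 0 < z := hy₀.trans_le hz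
      have hzm := hμ.pos z hz
      have := intervalIntegral.norm_integral_le_of_norm_le_const
        (C := B * (2 / y₀ ^ 2 * (μ y + 1) * |z - y|)) (a := μ y) (b := μ z)
        (f := fun t => hardyZSq t * (Real.exp (-(2 / z) * t) - Real.exp (-(2 / y) * t))) ?_
      · refine this.trans_eq ?_
        rw [norm_mul, Real.norm_eq_abs, Real.norm_eq_abs]
        ring
      · intro t ht
        have ht0 : 0 ≤ t := (le_min hm.le hzm.le).trans ht.1.le
        have ht1 : t ≤ μ y + 1 := ht.2.trans (max_le (by linarith) hz1.le)
        rw [norm_mul]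
        refine mul_le_mul (hB t ⟨ht0, ht1⟩) ?_ (norm_nonneg _) hB0
        rw [Real.norm_eq_abs, neg_mul, neg_mul]
        refine (abs_exp_neg_sub_exp_neg_le (by positivity) (by positivity)).trans ?_
        have e : 2 / z * t - 2 / y * t = -(2 / (z * y) * t * (z - y)) := by
          field_simp; ring
        rw [e, abs_neg, abs_mul, abs_of_nonneg (by positivity : 0 ≤ 2 / (z * y) * t)]
        have : y₀ ^ 2 ≤ z * y := by nlinarith
        gcongr
    refine hbig.trans_isLittleO ?_
    have h1 : (fun z => μ z - μ y) =o[𝓝[Ici y₀] y] fun _ => (1 : ℝ) := by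
      rw [Asymptotics.isLittleO_one_iff]
      simpa using hcont.sub_const (μ y)
    simpa using h1.mul_isBigO (Asymptotics.isBigO_refl (fun z => z - y) _)
  have hsum := (hG.add hH).add hR
  rw [add_zero] at hsum
  refine hsum.congr_of_mem (fun z _ => ?_) hy
  have i1 := (hc z).intervalIntegrable (μ := volume)
  have i2 := (hc y).intervalIntegrable (μ := volume)
  have e1 : ∫ t in (μ y)..(μ z), hardyZSq t * (Real.exp (-(2 / z) * t) - Real.exp (-(2 / y) * t))
      = (∫ t in (μ y)..(μ z), hardyZSq t * Real.exp (-(2 / z) * t))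
        - ∫ t in (μ y)..(μ z), hardyZSq t * Real.exp (-(2 / y) * t) := by
    rw [← intervalIntegral.integral_sub (i1 _ _) (i2 _ _)]
    simp only [mul_sub]
  have e2 := intervalIntegral.integral_add_adjacent_intervals (i1 0 (μ y)) (i1 (μ y) (μ z))
  simp only [Pi.add_apply, Function.comp_apply, Phi, e1]
  linarith

theorem exists_Phi_hasDerivWithinAt {μ : ℝ → ℝ} {y₀ : ℝ} (hμ : IsAdmissible μ y₀) {y : ℝ}
    (hy : y₀ ≤ y) : ∃ Φ' : ℝ, 0 < Φ' ∧ HasDerivWithinAt (Phi μ) Φ' (Ici y₀) y := by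
  have hy0 : 0 < y := hμ.pos_start.trans_le hy
  have hd : HasDerivWithinAt μ (derivWithin μ (Ici y₀) y) (Ici y₀) y :=
    ((hμ.contDiffOn.differentiableOn one_ne_zero) y hy).hasDerivWithinAt
  refine ⟨_, ?_, Phi_hasDerivWithinAt hμ hy hd⟩
  refine add_pos_of_pos_of_nonneg ?_ ?_
  · exact integral_hardyZSq_mul_pos (by fun_prop) (hμ.pos y hy) fun t ht => by positivity
  · exact mul_nonneg (mul_nonneg (hardyZSq_nonneg _) (Real.exp_pos _).le) hμ.monotoneOn.derivWithin_nonneg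

theorem continuousOn_Phi {μ : ℝ → ℝ} {y₀ : ℝ} (hμ : IsAdmissible μ y₀) :
    ContinuousOn (Phi μ) (Ici y₀) := fun _ hy =>
  (exists_Phi_hasDerivWithinAt hμ hy).choose_spec.2.continuousWithinAt

theorem deriv_Phi_pos {μ : ℝ → ℝ} {y₀ : ℝ} (hμ : IsAdmissible μ y₀) {y : ℝ} (hy : y₀ < y) :
    0 < deriv (Phi μ) y ∧ HasDerivAt (Phi μ) (deriv (Phi μ) y) y := by
  obtain ⟨Φ', h0, h⟩ := exists_Phi_hasDerivWithinAt hμ hy.le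
  have h' := h.hasDerivAt (Ici_mem_nhds hy)
  rw [h'.deriv]
  exact ⟨h0, h'⟩

theorem strictMonoOn_Phi {μ : ℝ → ℝ} {y₀ : ℝ} (hμ : IsAdmissible μ y₀) :
    StrictMonoOn (Phi μ) (Ici y₀) := by
  refine strictMonoOn_of_deriv_pos (convex_Ici y₀) (continuousOn_Phi hμ) fun y hy => ?_
  rw [interior_Ici] at hy
  exact (deriv_Phi_pos hμ hy).1

theorem phi_eq_of_Phi_eq {μ : ℝ → ℝ} {y₀ : ℝ} (hμ : IsAdmissible μ y₀) {y T : ℝ} (hy : y₀ ≤ y)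
    (h : Phi μ y = hardyLittlewood T) : phi μ y₀ T = y := by
  have hex : ∃ z ∈ Ici y₀, Phi μ z = hardyLittlewood T := ⟨y, hy, h⟩
  exact (strictMonoOn_Phi hμ).injOn (Function.invFunOn_mem hex) hy
    ((Function.invFunOn_eq hex).trans h.symm)

theorem Phi_le_hardyLittlewood {μ : ℝ → ℝ} {y : ℝ} (hy : 0 ≤ y) (hm : 0 ≤ μ y) :
    Phi μ y ≤ hardyLittlewood (μ y) := by
  refine intervalIntegral.integral_mono_on hm
    (Continuous.intervalIntegrable (continuous_hardyZSq.mul (by fun_prop)) _ _)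
    (continuous_hardyZSq.intervalIntegrable _ _) fun t ht => ?_
  refine mul_le_of_le_one_right (hardyZSq_nonneg t) (Real.exp_le_one_iff.2 ?_)
  have : 0 ≤ 2 / y * t := mul_nonneg (by positivity) ht.1
  linarith

theorem exists_mem_ladderDomain {μ : ℝ → ℝ} {y₀ : ℝ} (hμ : IsAdmissible μ y₀) {y : ℝ}
    (hy : y₀ ≤ y) : ∃ T ∈ ladderDomain μ y₀, hardyLittlewood T = Phi μ y := by
  have hy0 : 0 < y := hμ.pos_start.trans_le hy
  have hm := (hμ.pos y hy).le
  have h0 : hardyLittlewood 0 ≤ Phi μ y := by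
    rw [hardyLittlewood, intervalIntegral.integral_same]
    exact intervalIntegral.integral_nonneg hm fun t _ =>
      mul_nonneg (hardyZSq_nonneg t) (Real.exp_pos _).le
  obtain ⟨T, hT, hTe⟩ := intermediate_value_Icc hm continuous_hardyLittlewood.continuousOn
    ⟨h0, Phi_le_hardyLittlewood hy0.le hm⟩
  exact ⟨T, ⟨hT.1, y, hy, hTe.symm⟩, hTe⟩

/-- The inverse of the Jacob's ladder `φ₁`. -/
def ladderInv (μ : ℝ → ℝ) (y₀ : ℝ) : ℝ → ℝ :=
  Function.invFunOn (phi1 μ y₀) (ladderDomain μ y₀)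

theorem revIter_eq_iterate (μ : ℝ → ℝ) (y₀ : ℝ) (k : ℕ) (T : ℝ) :
    revIter μ y₀ k T = (ladderInv μ y₀)^[k] T := by
  induction k with
  | zero => rfl
  | succ k ih => rw [Function.iterate_succ_apply', ← ih]; rfl

theorem ladderInv_spec {μ : ℝ → ℝ} {y₀ : ℝ} (hμ : IsAdmissible μ y₀) {x : ℝ} (hx : y₀ ≤ 2 * x) :
    ladderInv μ y₀ x ∈ ladderDomain μ y₀ ∧ phi1 μ y₀ (ladderInv μ y₀ x) = x ∧
      hardyLittlewood (ladderInv μ y₀ x) = Phi μ (2 * x) := by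
  obtain ⟨T, hT, hTe⟩ := exists_mem_ladderDomain hμ hx
  have hex : ∃ T ∈ ladderDomain μ y₀, phi1 μ y₀ T = x :=
    ⟨T, hT, by rw [phi1, phi_eq_of_Phi_eq hμ hx hTe.symm]; ring⟩
  have hmem : ladderInv μ y₀ x ∈ ladderDomain μ y₀ := Function.invFunOn_mem hex
  have heq : phi1 μ y₀ (ladderInv μ y₀ x) = x := Function.invFunOn_eq hex
  refine ⟨hmem, heq, ?_⟩
  obtain ⟨_, y, hy, hyT⟩ := hmem
  have h1 := phi_eq_of_Phi_eq hμ hy hyT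
  rw [phi1, h1] at heq
  rw [← hyT, ← heq]
  congr 1
  ring

theorem ladderInv_monotoneOn {μ : ℝ → ℝ} {y₀ : ℝ} (hμ : IsAdmissible μ y₀) :
    MonotoneOn (ladderInv μ y₀) {x | y₀ ≤ 2 * x} := by
  intro a ha b hb hab
  rw [← strictMono_hardyLittlewood.le_iff_le, (ladderInv_spec hμ ha).2.2,
    (ladderInv_spec hμ hb).2.2]
  exact (strictMonoOn_Phi hμ).monotoneOn ha hb (by linarith)

theorem hasDerivAt_invFunOn_Phi {μ : ℝ → ℝ} {y₀ : ℝ} (hμ : IsAdmissible μ y₀) {y : ℝ}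
    (hy : y₀ < y) :
    HasDerivAt (Function.invFunOn (Phi μ) (Ici y₀)) (deriv (Phi μ) y)⁻¹ (Phi μ y) := by
  set G := Function.invFunOn (Phi μ) (Ici y₀) with hG
  have hmono := strictMonoOn_Phi hμ
  have hleft : ∀ z, y₀ ≤ z → G (Phi μ z) = z := fun z hz =>
    hmono.injOn.leftInvOn_invFunOn hz
  have hnhds : Phi μ '' Ioi y₀ ∈ 𝓝 (Phi μ y) := by
    obtain ⟨y₁, h1, h1'⟩ := exists_between hy
    refine mem_of_superset (Ioo_mem_nhds (hmono h1.le hy.le h1')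
      (hmono hy.le (show y₀ ≤ y + 1 by linarith) (lt_add_one y))) ?_
    refine (Ioo_subset_Icc_self.trans (intermediate_value_Icc (by linarith)
      ((continuousOn_Phi hμ).mono fun z hz => h1.le.trans hz.1))).trans ?_
    exact image_mono fun z hz => h1.trans_le hz.1
  have hGmono : StrictMonoOn G (Phi μ '' Ioi y₀) := by
    rintro _ ⟨a, ha, rfl⟩ _ ⟨b, hb, rfl⟩ hab
    rw [hleft a (le_of_lt ha), hleft b (le_of_lt hb)]
    exact (hmono.lt_iff_lt (Ioi_subset_Ici_self ha) (Ioi_subset_Ici_self hb)).1 hab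
  have himage : G '' (Phi μ '' Ioi y₀) = Ioi y₀ := by
    rw [image_image]
    exact (image_congr fun z hz => hleft z (le_of_lt hz)).trans (image_id _)
  have hGcont : ContinuousAt G (Phi μ y) := by
    refine hGmono.continuousAt_of_image_mem_nhds hnhds ?_
    rw [himage, hleft y hy.le]
    exact Ioi_mem_nhds hy
  obtain ⟨hpos, hder⟩ := deriv_Phi_pos hμ hy
  have hright : ∀ᶠ v in 𝓝 (Phi μ y), Phi μ (G v) = v := by
    filter_upwards [hnhds]
    rintro _ ⟨z, hz, rfl⟩
    rw [hleft z (le_of_lt hz)]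
  have hder' : HasDerivAt (Phi μ) (deriv (Phi μ) y) (G (Phi μ y)) := by rwa [hleft y hy.le]
  exact HasDerivAt.of_local_left_inverse hGcont hder' hpos.ne' hright

theorem hasDerivAt_phi1 {μ : ℝ → ℝ} {y₀ : ℝ} (hμ : IsAdmissible μ y₀) {y t : ℝ}
    (hy : y₀ < y) (h : Phi μ y = hardyLittlewood t) :
    HasDerivAt (phi1 μ y₀) (tildeZSq μ y₀ t) t ∧ 0 ≤ tildeZSq μ y₀ t := by
  have hphi := phi_eq_of_Phi_eq hμ hy.le h
  have hpos := (deriv_Phi_pos hμ hy).1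
  have h1 := hasDerivAt_invFunOn_Phi hμ hy
  rw [h] at h1
  have h2 := (h1.comp t (hasDerivAt_hardyLittlewood t)).div_const 2
  rw [tildeZSq, hphi]
  refine ⟨h2.congr_deriv ?_, div_nonneg (hardyZSq_nonneg t) (by positivity)⟩
  field_simp

theorem phi1_mem_Icc {μ : ℝ → ℝ} {y₀ : ℝ} (hμ : IsAdmissible μ y₀) {a b t : ℝ} (ha : y₀ < 2 * a)
    (hab : a ≤ b) (ht : t ∈ Icc (ladderInv μ y₀ a) (ladderInv μ y₀ b)) :
    phi1 μ y₀ t ∈ Icc a b ∧ ∃ y, y₀ < y ∧ Phi μ y = hardyLittlewood t := by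
  have h1 := strictMono_hardyLittlewood.monotone ht.1
  have h2 := strictMono_hardyLittlewood.monotone ht.2
  rw [(ladderInv_spec hμ ha.le).2.2] at h1
  rw [(ladderInv_spec hμ (show y₀ ≤ 2 * b by linarith)).2.2] at h2
  obtain ⟨y, hy, hyt⟩ := intermediate_value_Icc (by linarith : 2 * a ≤ 2 * b)
    ((continuousOn_Phi hμ).mono fun z hz => ha.le.trans hz.1) ⟨h1, h2⟩
  have hy0 : y₀ < y := ha.trans_le hy.1
  refine ⟨?_, y, hy0, hyt⟩
  rw [phi1, phi_eq_of_Phi_eq hμ hy0.le hyt]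
  constructor <;> linarith [hy.1, hy.2]

section InvariantHalfLine

variable {μ : ℝ → ℝ} {y₀ x₀ : ℝ}

theorem ladderInv_iterate_ge (hinv : ∀ x, x₀ ≤ x → x₀ ≤ ladderInv μ y₀ x) {x : ℝ} (hx : x₀ ≤ x)
    (k : ℕ) : x₀ ≤ (ladderInv μ y₀)^[k] x := by
  induction k with
  | zero => exact hx
  | succ k ih => rw [Function.iterate_succ_apply']; exact hinv _ ih

theorem ladderInv_iterate_mono (hμ : IsAdmissible μ y₀) (hx₀ : y₀ < 2 * x₀)
    (hinv : ∀ x, x₀ ≤ x → x₀ ≤ ladderInv μ y₀ x) {a b : ℝ} (ha : x₀ ≤ a) (hab : a ≤ b) (k : ℕ) :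
    (ladderInv μ y₀)^[k] a ≤ (ladderInv μ y₀)^[k] b := by
  induction k with
  | zero => exact hab
  | succ k ih =>
    rw [Function.iterate_succ_apply', Function.iterate_succ_apply']
    have h1 := ladderInv_iterate_ge hinv ha k
    have h2 := ladderInv_iterate_ge hinv (ha.trans hab) k
    exact ladderInv_monotoneOn hμ (show y₀ ≤ 2 * _ by linarith) (show y₀ ≤ 2 * _ by linarith) ih

theorem phi1_iterate_ladderInv_iterate (hμ : IsAdmissible μ y₀) (hx₀ : y₀ < 2 * x₀)
    (hinv : ∀ x, x₀ ≤ x → x₀ ≤ ladderInv μ y₀ x) {a : ℝ} (ha : x₀ ≤ a) (k : ℕ) :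
    (phi1 μ y₀)^[k] ((ladderInv μ y₀)^[k] a) = a := by
  induction k with
  | zero => rfl
  | succ k ih =>
    have h1 := ladderInv_iterate_ge hinv ha k
    rw [Function.iterate_succ_apply, Function.iterate_succ_apply' (ladderInv μ y₀),
      (ladderInv_spec hμ (by linarith)).2.1, ih]

theorem hasRevIter_of_ge (hμ : IsAdmissible μ y₀) (hx₀ : y₀ < 2 * x₀)
    (hinv : ∀ x, x₀ ≤ x → x₀ ≤ ladderInv μ y₀ x) {x : ℝ} (hx : x₀ ≤ x) (k : ℕ) :
    HasRevIter μ y₀ k x := by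
  intro j _
  have h1 := ladderInv_iterate_ge hinv hx j
  have h2 := ladderInv_spec hμ (x := (ladderInv μ y₀)^[j] x) (by linarith)
  rw [revIter_eq_iterate, revIter_eq_iterate, Function.iterate_succ_apply']
  exact ⟨h2.1, h2.2.1⟩

theorem hasDerivAt_phi1_iterate (hμ : IsAdmissible μ y₀) (hx₀ : y₀ < 2 * x₀)
    (hinv : ∀ x, x₀ ≤ x → x₀ ≤ ladderInv μ y₀ x) {a b : ℝ} (ha : x₀ ≤ a) (hab : a ≤ b) (s : ℕ) :
    ∀ t ∈ Icc ((ladderInv μ y₀)^[s] a) ((ladderInv μ y₀)^[s] b),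
      HasDerivAt ((phi1 μ y₀)^[s])
        (∏ r ∈ Finset.range s, tildeZSq μ y₀ ((phi1 μ y₀)^[r] t)) t ∧
      0 ≤ ∏ r ∈ Finset.range s, tildeZSq μ y₀ ((phi1 μ y₀)^[r] t) := by
  induction s with
  | zero =>
    intro t _
    simpa using hasDerivAt_id t
  | succ s ih =>
    intro t ht
    rw [Function.iterate_succ_apply', Function.iterate_succ_apply'] at ht
    have h1 := ladderInv_iterate_ge hinv ha s
    obtain ⟨hmem, y, hy, hyt⟩ := phi1_mem_Icc hμ (by linarith)
      (ladderInv_iterate_mono hμ hx₀ hinv ha hab s) ht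
    obtain ⟨hd, hn⟩ := hasDerivAt_phi1 hμ hy hyt
    obtain ⟨ihd, ihn⟩ := ih _ hmem
    rw [Finset.prod_range_succ']
    simp only [Function.iterate_succ_apply, Function.iterate_zero, id_eq]
    exact ⟨ihd.comp t hd, mul_nonneg ihn hn⟩

theorem integral_prod_tildeZSq (hμ : IsAdmissible μ y₀) (hx₀ : y₀ < 2 * x₀)
    (hinv : ∀ x, x₀ ≤ x → x₀ ≤ ladderInv μ y₀ x) {a b : ℝ} (ha : x₀ ≤ a) (hab : a ≤ b) (s : ℕ) :
    ∫ t in ((ladderInv μ y₀)^[s] a)..((ladderInv μ y₀)^[s] b),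
      ∏ r ∈ Finset.range s, tildeZSq μ y₀ ((phi1 μ y₀)^[r] t) = b - a := by
  have hle := ladderInv_iterate_mono hμ hx₀ hinv ha hab s
  have hd := hasDerivAt_phi1_iterate hμ hx₀ hinv ha hab s
  have hcont : ContinuousOn ((phi1 μ y₀)^[s])
      (Icc ((ladderInv μ y₀)^[s] a) ((ladderInv μ y₀)^[s] b)) :=
    fun t ht => (hd t ht).1.continuousAt.continuousWithinAt
  rw [intervalIntegral.integral_eq_sub_of_hasDerivAt_of_le hle hcont
    (fun t ht => (hd t (Ioo_subset_Icc_self ht)).1)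
    ((intervalIntegrable_iff_integrableOn_Ioc_of_le hle).2
      (intervalIntegral.integrableOn_deriv_of_nonneg hcont
        (fun t ht => (hd t (Ioo_subset_Icc_self ht)).1)
        (fun t ht => (hd t (Ioo_subset_Icc_self ht)).2))),
    phi1_iterate_ladderInv_iterate hμ hx₀ hinv ha,
    phi1_iterate_ladderInv_iterate hμ hx₀ hinv (ha.trans hab)]

end InvariantHalfLine

theorem exists_ladderInv_invariant {μ : ℝ → ℝ} {y₀ : ℝ} (hμ : IsAdmissible μ y₀) :
    ∃ x₀, y₀ < 2 * x₀ ∧ ∀ x, x₀ ≤ x → x₀ ≤ ladderInv μ y₀ x := by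
  obtain ⟨x₀, hx, hlt⟩ := exists_hardyLittlewood_lt_Phi hμ (y₀ / 2)
  have h0 : y₀ < 2 * x₀ := by linarith
  refine ⟨x₀, h0, fun x hxx => ?_⟩
  rw [← (ladderInv_spec hμ h0.le).2.2] at hlt
  exact (strictMono_hardyLittlewood.lt_iff_lt.1 hlt).le.trans
    (ladderInv_monotoneOn hμ h0.le (show y₀ ≤ 2 * x by linarith) hxx)

end

end JacobLadder

theorem theorem1 (μ : ℝ → ℝ) (y₀ : ℝ) (hμ : JacobLadder.IsAdmissible μ y₀)
    (g : ℝ) (hg : 0 < g) :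
    ∃ T₀ : ℝ, 0 < T₀ ∧ ∀ k₀ : ℕ, 2 ≤ k₀ → ∀ T : ℝ, T₀ < T →
      ∀ k : ℕ, 2 ≤ k → k ≤ k₀ → ∀ p s : ℕ, 1 ≤ s → s + 1 ≤ p → p ≤ k →
        JacobLadder.HasRevIter μ y₀ p T ∧
        JacobLadder.HasRevIter μ y₀ s (JacobLadder.revIter μ y₀ (p - s) T + g) ∧
        (∫ t in (JacobLadder.revIter μ y₀ p T)..(JacobLadder.revIter μ y₀ s
              (JacobLadder.revIter μ y₀ (p - s) T + g)),
            ∏ r ∈ Finset.range s, JacobLadder.tildeZSq μ y₀ ((JacobLadder.phi1 μ y₀)^[r] t)) = g := by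
  obtain ⟨x₀, h0, hinv⟩ := JacobLadder.exists_ladderInv_invariant hμ
  have hy₀ := hμ.pos_start
  refine ⟨x₀, by linarith, fun k₀ _ T hT k _ _ p s _ hsp _ => ?_⟩
  have ha : x₀ ≤ JacobLadder.revIter μ y₀ (p - s) T := by
    rw [JacobLadder.revIter_eq_iterate]
    exact JacobLadder.ladderInv_iterate_ge hinv hT.le _
  refine ⟨JacobLadder.hasRevIter_of_ge hμ h0 hinv hT.le p,
    JacobLadder.hasRevIter_of_ge hμ h0 hinv (by linarith) s, ?_⟩
  have hsplit : JacobLadder.revIter μ y₀ p T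
      = (JacobLadder.ladderInv μ y₀)^[s] (JacobLadder.revIter μ y₀ (p - s) T) := by
    rw [JacobLadder.revIter_eq_iterate, JacobLadder.revIter_eq_iterate,
      ← Function.iterate_add_apply, Nat.add_sub_cancel' (by omega)]
  rw [hsplit, JacobLadder.revIter_eq_iterate μ y₀ s,
    JacobLadder.integral_prod_tildeZSq hμ h0 hinv ha (by linarith) s, add_sub_cancel_left]
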